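/- **Theorem (Weak Degeneracy Criterion).** Conventions. Algebras are associative and unital, and algebra homomorphisms are unital. For an algebra $A$ over a commutative ring $k$ and an $A$-bimodule $N$ (on which $k$ acts symmetrically), $HH^n(A,N)$ is the $n$-th cohomology of the Hochschild cochain complex $C^n(A,N)=\operatorname{Hom}_k(A^{\otimes_k n},N)$, and $$HCHDim(A)=\sup\{n : HH^n(A,N)\neq 0 \text{ for some } A\text{-bimodule } N\}.$$ $A$ is *quasi-free* over $k$ (Cuntz–Quillen) if every $k$-algebra homomorphism $A\to C$ lifts along every surjection $B\to C$ of (not necessarily commutative) $k$-algebras with square-zero kernel. For a commutative ring $A$, the weak dimension $wD(A)$ is the supremum over all $A$-modules of their flat dimensions, the projective dimension $pD(A)$ is the supremum over all $A$-modules of their projective dimensions, and, if $A$ is a $k$-algebra, $\operatorname{pd}_{A^e}(A)$ is the projective dimension of $A$ as a module over $A^e=A\otimes_k A$. The $k$-relative versions $wD_{A/k}$, $pD_{A/k}$, $\operatorname{pd}_{A^e/k}(A)$ are obtained by admitting only resolutions that are split as sequences of $k$-modules and consist of relatively flat modules (those for which tensoring keeps $k$-split injections injective), respectively of relatively projective modules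 (those that lift along $k$-split surjections). A commutative ring $A$ is *Cohen–Macaulay at a maximal ideal* $\mathfrak m$ if $A_{\mathfrak m}$ has a regular sequence (with nonzero final quotient) of maximal length whose length is the Krull dimension of $A_{\mathfrak m}$. $A$ is *regular* if it is Noetherian and all its localizations at primes are regular local rings. **(0)** Let $A$ be a commutative algebra over a commutative ring $k$. Then $wD_{A/k}(A)$, $pD_{A/k}(A)$ and $\operatorname{pd}_{A^e/k}(A)$ are all at most $HCHDim(A)$. If $k$ is a field, then moreover $wD(A)$, $pD(A)$ and $\operatorname{pd}_{A^e}(A)$ are all at most $HCHDim(A)$. Suppose now that $k$ is a field and $A$ is a commutative $k$-algebra. **(1)** If $A$ is Cohen–Macaulay at a maximal ideal $\mathfrak m$, then $\operatorname{Krull}(A_{\mathfrak m})\le HCHDim(A)$; if in addition $\operatorname{Krull}(A_{\mathfrak m})\ge 2$, then $A$ is not quasi-free over $k$. **(2)** If $A$ is regular, then $\operatorname{Krull}(A)\le HCHDim(A)$; if in addition $\operatorname{Krull}(A)\ge 2$, then $A$ is not quasi-free over $k$. -/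

import Mathlib

open scoped TensorProduct

universe u v w

/-! ## Hochschild cohomology of an associative algebra -/

section Hochschild

/-- Changing one entry of a tuple changes exactly one entry of the contracted tuple
`(a₀, …, aᵢ aᵢ₊₁, …, aₙ)`, and does so through a `k`-linear map. -/
theorem exists_contractNth_update (k : Type u) (A : Type v) [CommRing k] [Ring A] [Algebra k A]
    {n : ℕ} (i : Fin n) (a : Fin (n + 1) → A) (l : Fin (n + 1)) :
    ∃ (j : Fin n) (φ : A →ₗ[k] A), ∀ x : A,
      Fin.contractNth i.castSucc (· * ·) (Function.update a l x) =
        Function.update (Fin.contractNth i.castSucc (· * ·) a) j (φ x) := by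
  have key : ∀ (b : Fin (n + 1) → A) (j : Fin n),
      Fin.contractNth i.castSucc (· * ·) b j =
        if (j : ℕ) < i then b j.castSucc
        else if (j : ℕ) = i then b j.castSucc * b j.succ else b j.succ := fun b j => rfl
  rcases lt_trichotomy (l : ℕ) (i : ℕ) with h | h | h
  · refine ⟨⟨l, by omega⟩, LinearMap.id, fun x => ?_⟩
    funext j
    simp only [key, Function.update_apply, Fin.ext_iff, Fin.val_castSucc, Fin.val_succ,
      LinearMap.id_apply]
    split_ifs <;> first | rfl | omega
  · refine ⟨i, LinearMap.mulRight k (a i.succ), fun x => ?_⟩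
    funext j
    simp only [key, Function.update_apply, Fin.ext_iff, Fin.val_castSucc, Fin.val_succ,
      LinearMap.mulRight_apply]
    split_ifs <;> first
      | rfl
      | omega
      | (have hj : j = i := Fin.ext (by omega)
         subst hj; rfl)
  · by_cases h' : (l : ℕ) = i + 1
    · refine ⟨i, LinearMap.mulLeft k (a i.castSucc), fun x => ?_⟩
      funext j
      simp only [key, Function.update_apply, Fin.ext_iff, Fin.val_castSucc, Fin.val_succ,
        LinearMap.mulLeft_apply]
      split_ifs <;> first
        | rfl
        | omega
        | (have hj : j = i := Fin.ext (by omega)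
           subst hj; rfl)
    · refine ⟨⟨l - 1, by omega⟩, LinearMap.id, fun x => ?_⟩
      funext j
      simp only [key, Function.update_apply, Fin.ext_iff, Fin.val_castSucc, Fin.val_succ,
        LinearMap.id_apply]
      split_ifs <;> first | rfl | omega

variable (k : Type u) (A : Type v) [CommRing k] [Ring A] [Algebra k A]
variable (N : Type w) [AddCommGroup N] [Module k N] [Module A N] [Module Aᵐᵒᵖ N]
  [IsScalarTower k A N] [IsScalarTower k Aᵐᵒᵖ N] [SMulCommClass A Aᵐᵒᵖ N]

/-- Hochschild `n`-cochains of `A` with values in the `A`-bimodule `N`: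
the `k`-multilinear maps `Aⁿ → N`, i.e. `Hom_k (A^{⊗n}, N)`. -/
abbrev HochschildCochain (n : ℕ) : Type max v w :=
  MultilinearMap k (fun _ : Fin n => A) N

variable {k A N} in
/-- The term `(a₀, …, aₙ) ↦ a₀ f(a₁, …, aₙ)`. -/
def hochschildFirst {n : ℕ} (f : HochschildCochain k A N n) : HochschildCochain k A N (n + 1) where
  toFun a := a 0 • f (Fin.tail a)
  map_update_add' {inst} a l x y := by
    obtain rfl : inst = instDecidableEqFin (n + 1) := Subsingleton.elim _ _
    refine Fin.cases ?_ (fun l => ?_) l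
    · simp [Fin.tail_update_zero, add_smul]
    · simp [Fin.tail_update_succ, Function.update_of_ne (Fin.succ_ne_zero l).symm, f.map_update_add, smul_add]
  map_update_smul' {inst} a l c x := by
    obtain rfl : inst = instDecidableEqFin (n + 1) := Subsingleton.elim _ _
    refine Fin.cases ?_ (fun l => ?_) l
    · simp [Fin.tail_update_zero]
    · simp [Fin.tail_update_succ, Function.update_of_ne (Fin.succ_ne_zero l).symm, f.map_update_smul, smul_comm c]

variable {k A N} in
/-- The term `(a₀, …, aₙ) ↦ f(a₀, …, aᵢ aᵢ₊₁, …, aₙ)`. -/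
def hochschildMiddle {n : ℕ} (i : Fin n) (f : HochschildCochain k A N n) :
    HochschildCochain k A N (n + 1) where
  toFun a := f (Fin.contractNth i.castSucc (· * ·) a)
  map_update_add' {inst} a l x y := by
    obtain rfl : inst = instDecidableEqFin (n + 1) := Subsingleton.elim _ _
    obtain ⟨j, φ, h⟩ := exists_contractNth_update k A i a l
    rw [h, h, h, map_add, f.map_update_add]
  map_update_smul' {inst} a l c x := by
    obtain rfl : inst = instDecidableEqFin (n + 1) := Subsingleton.elim _ _
    obtain ⟨j, φ, h⟩ := exists_contractNth_update k A i a l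
    rw [h, h, map_smul, f.map_update_smul]

variable {k A N} in
/-- The term `(a₀, …, aₙ) ↦ f(a₀, …, aₙ₋₁) aₙ`. -/
def hochschildLast {n : ℕ} (f : HochschildCochain k A N n) : HochschildCochain k A N (n + 1) where
  toFun a := MulOpposite.op (a (Fin.last n)) • f (Fin.init a)
  map_update_add' {inst} a l x y := by
    obtain rfl : inst = instDecidableEqFin (n + 1) := Subsingleton.elim _ _
    refine Fin.lastCases ?_ (fun l => ?_) l
    · simp [Fin.init_update_last, add_smul]
    · simp [Fin.init_update_castSucc, f.map_update_add, smul_add, (Fin.castSucc_ne_last l).symm]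
  map_update_smul' {inst} a l c x := by
    obtain rfl : inst = instDecidableEqFin (n + 1) := Subsingleton.elim _ _
    refine Fin.lastCases ?_ (fun l => ?_) l
    · simp [Fin.init_update_last]
    · simp [Fin.init_update_castSucc, f.map_update_smul, (Fin.castSucc_ne_last l).symm, smul_comm c]

/-- The Hochschild coboundary `C^n(A, N) → C^{n+1}(A, N)`,
`(df)(a₀, …, aₙ) = a₀ f(a₁, …, aₙ) + ∑_{i < n} (-1)^{i+1} f(a₀, …, aᵢ aᵢ₊₁, …, aₙ)
  + (-1)^{n+1} f(a₀, …, aₙ₋₁) aₙ`. -/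
def hochschildD (n : ℕ) : HochschildCochain k A N n →ₗ[k] HochschildCochain k A N (n + 1) where
  toFun f := hochschildFirst f + ∑ i : Fin n, (-1 : k) ^ ((i : ℕ) + 1) • hochschildMiddle i f
    + (-1 : k) ^ (n + 1) • hochschildLast f
  map_add' f g := by
    ext a
    simp [hochschildFirst, hochschildMiddle, hochschildLast, Finset.sum_add_distrib]
    abel
  map_smul' c f := by
    ext a
    simp only [hochschildFirst, hochschildMiddle, hochschildLast, add_apply,
      smul_apply, sum_apply, MultilinearMap.coe_mk, smul_add,
      Finset.smul_sum, RingHom.id_apply]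
    simp only [smul_comm _ c]

/-- The coboundaries in degree `n`: the image of the preceding coboundary map
(zero in degree `0`). -/
def hochschildCoboundaries : (n : ℕ) → Submodule k (HochschildCochain k A N n)
  | 0 => ⊥
  | n + 1 => LinearMap.range (hochschildD k A N n)

/-- The `n`-th Hochschild cohomology `HH^n(A, N)`: cocycles modulo coboundaries. -/
abbrev HochschildCohomology (n : ℕ) : Type max v w :=
  LinearMap.ker (hochschildD k A N n) ⧸
    (hochschildCoboundaries k A N n).comap (LinearMap.ker (hochschildD k A N n)).subtype

end Hochschild

section QuasiFree

variable (k : Type u) (A : Type v) [CommRing k] [Ring A] [Algebra k A]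

/-- The Hochschild cohomological dimension of the `k`-algebra `A`: the supremum of the `n` such
that `HH^n(A, N) ≠ 0` for some `A`-bimodule `N` (on which both `k`-actions agree). -/
noncomputable def HCHDim : ℕ∞ :=
  ⨆ (n : ℕ) (_ : ∃ (N : Type v) (_ : AddCommGroup N) (_ : Module k N) (_ : Module A N)
      (_ : Module Aᵐᵒᵖ N) (_ : IsScalarTower k A N) (_ : IsScalarTower k Aᵐᵒᵖ N)
      (_ : SMulCommClass A Aᵐᵒᵖ N), Nontrivial (HochschildCohomology k A N n)), (n : ℕ∞)

/-- `A` is quasi-free over `k` (Cuntz–Quillen): homomorphisms of (not necessarily commutative)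
`k`-algebras out of `A` lift along every surjection `B → C` with square-zero kernel. -/
def IsQuasiFree : Prop :=
  ∀ (B C : Type v) [Ring B] [Ring C] [Algebra k B] [Algebra k C] (p : B →ₐ[k] C),
    Function.Surjective p → (∀ x y : B, p x = 0 → p y = 0 → x * y = 0) →
      ∀ g : A →ₐ[k] C, ∃ h : A →ₐ[k] B, p.comp h = g

end QuasiFree

/-! ## Homological dimensions -/

section Dimension

/-- `HasFlatDimensionLE A n M`: the `A`-module `M` has a resolution
`0 → Fₙ → ⋯ → F₀ → M → 0` by flat modules (built from successive syzygies). -/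
def HasFlatDimensionLE (A : Type v) [CommRing A] :
    ℕ → ∀ (M : Type v) [AddCommGroup M] [Module A M], Prop
  | 0, M, _, _ => Module.Flat A M
  | n + 1, M, _, _ => ∃ (F : Type v) (_ : AddCommGroup F) (_ : Module A F) (f : F →ₗ[A] M),
      Module.Flat A F ∧ Function.Surjective f ∧ HasFlatDimensionLE A n (LinearMap.ker f)

/-- The flat dimension of a module: the shortest length of a flat resolution. -/
noncomputable def flatDimension (A : Type v) [CommRing A] (M : Type v) [AddCommGroup M]
    [Module A M] : ℕ∞ :=
  ⨅ (n : ℕ) (_ : HasFlatDimensionLE A n M), (n : ℕ∞)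

/-- The weak (global) dimension of `A`: the supremum of the flat dimensions of its modules. -/
noncomputable def weakDimension (A : Type v) [CommRing A] : ℕ∞ :=
  ⨆ M : ModuleCat.{v} A, flatDimension A M

/-- The (global) projective dimension of `A`: the supremum of the projective dimensions of its
modules. -/
noncomputable def globalProjectiveDimension (A : Type v) [CommRing A] : WithBot ℕ∞ :=
  ⨆ M : ModuleCat.{v} A, CategoryTheory.projectiveDimension M

/-- `A` as a module over its enveloping algebra `A ⊗ₖ A` (`A` being commutative, `A` equals its
opposite), that is, as a bimodule over itself: `(a ⊗ b) • x = a x b`. -/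
noncomputable def diagonalBimodule (k : Type u) (A : Type v) [CommRing k] [CommRing A]
    [Algebra k A] : ModuleCat.{v} (A ⊗[k] A) :=
  (ModuleCat.restrictScalars (Algebra.TensorProduct.lmul' k : A ⊗[k] A →ₐ[k] A).toRingHom).obj
    (ModuleCat.of A A)

end Dimension

/-! ## Homological dimensions relative to the base ring

These are the notions of relative homological algebra: only `k`-split exact sequences are
admitted. If `k` is a field, every exact sequence is `k`-split. -/

section Relative

/-- The `A`-linear map `f` is a `k`-split surjection: it has a `k`-linear section. -/
def IsSplitSurjectionOver (k : Type u) {A : Type v} [CommRing k] [CommRing A] [Algebra k A]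
    {X Y : Type v} [AddCommGroup X] [Module A X] [AddCommGroup Y] [Module A Y]
    (f : X →ₗ[A] Y) : Prop :=
  ∃ s : Y →+ X, (∀ (c : k) (y : Y), s (algebraMap k A c • y) = algebraMap k A c • s y) ∧
    ∀ y, f (s y) = y

/-- The `A`-linear map `f` is a `k`-split injection: it has a `k`-linear retraction. -/
def IsSplitInjectionOver (k : Type u) {A : Type v} [CommRing k] [CommRing A] [Algebra k A]
    {X Y : Type v} [AddCommGroup X] [Module A X] [AddCommGroup Y] [Module A Y]
    (f : X →ₗ[A] Y) : Prop :=
  ∃ r : Y →+ X, (∀ (c : k) (y : Y), r (algebraMap k A c • y) = algebraMap k A c • r y) ∧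
    ∀ x, r (f x) = x

/-- `P` is projective relative to `k`: it lifts along all `k`-split surjections of `A`-modules. -/
def IsRelativelyProjective (k : Type u) (A : Type v) [CommRing k] [CommRing A] [Algebra k A]
    (P : Type v) [AddCommGroup P] [Module A P] : Prop :=
  ∀ (X Y : Type v) [AddCommGroup X] [Module A X] [AddCommGroup Y] [Module A Y] (f : X →ₗ[A] Y),
    IsSplitSurjectionOver k f → ∀ g : P →ₗ[A] Y, ∃ h : P →ₗ[A] X, f ∘ₗ h = g

/-- `P` is flat relative to `k`: tensoring with `P` preserves the injectivity of all `k`-split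
injections of `A`-modules. -/
def IsRelativelyFlat (k : Type u) (A : Type v) [CommRing k] [CommRing A] [Algebra k A]
    (P : Type v) [AddCommGroup P] [Module A P] : Prop :=
  ∀ (X Y : Type v) [AddCommGroup X] [Module A X] [AddCommGroup Y] [Module A Y] (f : X →ₗ[A] Y),
    IsSplitInjectionOver k f → Function.Injective (f.lTensor P)

/-- `M` has a `k`-split resolution `0 → Pₙ → ⋯ → P₀ → M → 0` by relatively projective modules. -/
def HasRelativeProjectiveDimensionLE (k : Type u) (A : Type v) [CommRing k] [CommRing A]
    [Algebra k A] : ℕ → ∀ (M : Type v) [AddCommGroup M] [Module A M], Prop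
  | 0, M, _, _ => IsRelativelyProjective k A M
  | n + 1, M, _, _ => ∃ (P : Type v) (_ : AddCommGroup P) (_ : Module A P) (f : P →ₗ[A] M),
      IsRelativelyProjective k A P ∧ IsSplitSurjectionOver k f ∧
        HasRelativeProjectiveDimensionLE k A n (LinearMap.ker f)

/-- `M` has a `k`-split resolution `0 → Fₙ → ⋯ → F₀ → M → 0` by relatively flat modules. -/
def HasRelativeFlatDimensionLE (k : Type u) (A : Type v) [CommRing k] [CommRing A]
    [Algebra k A] : ℕ → ∀ (M : Type v) [AddCommGroup M] [Module A M], Prop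
  | 0, M, _, _ => IsRelativelyFlat k A M
  | n + 1, M, _, _ => ∃ (F : Type v) (_ : AddCommGroup F) (_ : Module A F) (f : F →ₗ[A] M),
      IsRelativelyFlat k A F ∧ IsSplitSurjectionOver k f ∧
        HasRelativeFlatDimensionLE k A n (LinearMap.ker f)

variable (k : Type u) (A : Type v) [CommRing k] [CommRing A] [Algebra k A]

/-- The `k`-relative projective dimension of an `A`-module. -/
noncomputable def relativeProjectiveDimension (M : Type v) [AddCommGroup M] [Module A M] : ℕ∞ :=
  ⨅ (n : ℕ) (_ : HasRelativeProjectiveDimensionLE k A n M), (n : ℕ∞)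

/-- The `k`-relative flat dimension of an `A`-module. -/
noncomputable def relativeFlatDimension (M : Type v) [AddCommGroup M] [Module A M] : ℕ∞ :=
  ⨅ (n : ℕ) (_ : HasRelativeFlatDimensionLE k A n M), (n : ℕ∞)

/-- The `k`-relative weak dimension of `A`: the supremum of the `k`-relative flat dimensions of
its modules. -/
noncomputable def relativeWeakDimension : ℕ∞ :=
  ⨆ M : ModuleCat.{v} A, relativeFlatDimension k A M

/-- The `k`-relative (global) projective dimension of `A`. -/
noncomputable def relativeGlobalProjectiveDimension : ℕ∞ :=
  ⨆ M : ModuleCat.{v} A, relativeProjectiveDimension k A M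

end Relative

/-! ## Cohen–Macaulay at a prime -/

/-- `A` is Cohen–Macaulay at the prime `p`: there is an `A_p`-regular sequence in `A_p`, of maximal
length among all such sequences, whose length is the Krull dimension of `A_p`. -/
def IsCohenMacaulayAt (A : Type v) [CommRing A] (p : Ideal A) [p.IsPrime] : Prop :=
  ∃ rs : List (Localization.AtPrime p),
    RingTheory.Sequence.IsRegular (Localization.AtPrime p) rs ∧
    (∀ rs' : List (Localization.AtPrime p),
      RingTheory.Sequence.IsRegular (Localization.AtPrime p) rs' → rs'.length ≤ rs.length) ∧
    ((rs.length : ℕ∞) : WithBot ℕ∞) = ringKrullDim (Localization.AtPrime p)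

/-!
The relative statements rest on one dimension shift. Let `S → T` be a homomorphism of commutative
`k`-algebras and `ι : A → T` a homomorphism exhibiting `T` as the base change `S ⊗ A`; the two cases
used are `S = k`, `T = A` and `S = A`, `T = A ⊗ A`. For a `T`-module `M` the action map
`T ⊗[S] M → M` is split over `S`, with kernel the syzygy `K`, and
`D(a, m) = ι a ⊗ m - 1 ⊗ ι a m` is a one-cocycle of `A` with values in `Hom_S(M, K)`. If `f` is a
cocycle with values in `Hom_S(K, N)`, the cup product of `f` and `D` is a cocycle with values in
`Hom_S(M, N)`. When it is the coboundary of `h`, the formula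
`g(b₁, …, bₙ)(ι a ⊗ m) = h(b₁, …, bₙ, a)(m)` defines, after restriction to `K`, a primitive `g` of
`f` (`HochschildVanishing.syzygy`). Hence the vanishing of `HH^{n+1}(A, -)` passes to
`HH^1(A, Hom_S(Kₙ, -)) = 0` for the `n`-th iterated syzygy `Kₙ`, and a primitive of `D` itself
turns the `S`-linear section `m ↦ 1 ⊗ m` of `T ⊗[S] Kₙ → Kₙ` into a `T`-linear one
(`HochschildVanishing.exists_section`). So `Kₙ` is a summand of an extended module, which makes it
relatively projective and relatively flat, and the relative dimensions are at most `n`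
(`HochschildVanishing.hasRelativeDimensionLE`). Over a field every exact sequence splits, and the
relative dimensions bound the absolute ones.

For the Krull dimension, let `R` be a localization of `A`, let `r₁, …, r_d` be an `R`-regular
sequence and `N = R / (r₁, …, r_d)`. Multiplication by `rᵢ` induces zero on `Ext_A(M, N)` for every
`R`-module `M`, so each quotient step raises by one the degree of a nonzero class in `Ext_A(-, N)`,
starting from `R → N` in degree zero. Thus `d` is at most the global dimension of `A`
(`length_le_of_isRegular_of_globalProjectiveDimension_le`), with no finiteness assumption on `A`.
At a Cohen–Macaulay point such a sequence of length the Krull dimension is given; a regular local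
ring has one because it is a domain and stays regular modulo an element of `m` outside `m²`
(`exists_isWeaklyRegular_of_isRegularLocalRing`).

Finally, a quasi-free algebra has `HH^2(A, -) = 0`, since the square-zero extension twisted by a
two-cocycle splits (`IsQuasiFree.hochschildCoboundary`). Its global dimension is then at most one,
and so is the Krull dimension in the cases considered.
-/

set_option linter.unusedSectionVars false

/-! ### The Hochschild coboundary and bimodules of homomorphisms -/

section HochschildFormulas

variable {k : Type u} {A : Type v} [CommRing k] [Ring A] [Algebra k A]
variable {N : Type w} [AddCommGroup N] [Module k N] [Module A N] [Module Aᵐᵒᵖ N]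
  [IsScalarTower k A N] [IsScalarTower k Aᵐᵒᵖ N] [SMulCommClass A Aᵐᵒᵖ N]

theorem hochschildD_apply {n : ℕ} (f : HochschildCochain k A N n) (a : Fin (n + 1) → A) :
    hochschildD k A N n f a = a 0 • f (Fin.tail a)
      + ∑ i : Fin n, (-1 : k) ^ ((i : ℕ) + 1) • f (Fin.contractNth i.castSucc (· * ·) a)
      + (-1 : k) ^ (n + 1) • (MulOpposite.op (a (Fin.last n)) • f (Fin.init a)) := by
  simp [hochschildD, hochschildFirst, hochschildMiddle, hochschildLast]

theorem Fin.contractNth_castSucc_castSucc_snoc {α : Type*} {n : ℕ} (op : α → α → α) (i : Fin n)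
    (b : Fin (n + 1) → α) (x : α) :
    Fin.contractNth i.castSucc.castSucc op (Fin.snoc b x : Fin (n + 2) → α) =
      (Fin.snoc (Fin.contractNth i.castSucc op b) x : Fin (n + 1) → α) := by
  funext j
  refine Fin.lastCases ?_ (fun j => ?_) j
  · have h : ¬ (n < (i : ℕ)) := by omega
    have h' : ¬ (n = (i : ℕ)) := by omega
    simp [Fin.contractNth, h, h']
  · simp only [Fin.contractNth, Fin.snoc_castSucc, Fin.val_castSucc, ← Fin.castSucc_succ]

theorem Fin.contractNth_castSucc_last_snoc {α : Type*} {n : ℕ} (op : α → α → α)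
    (b : Fin (n + 1) → α) (x : α) :
    Fin.contractNth (Fin.last n).castSucc op (Fin.snoc b x : Fin (n + 2) → α) =
      (Fin.snoc (Fin.init b) (op (b (Fin.last n)) x) : Fin (n + 1) → α) := by
  funext j
  refine Fin.lastCases ?_ (fun j => ?_) j
  · simp [Fin.contractNth]
  · simp [Fin.contractNth, Fin.init]

/-- The Hochschild coboundary of `h`, with the last argument `x` singled out: apart from the last
term, it is the coboundary of `b ↦ h (b, x)` for the right action that multiplies `x` from the
left. -/
theorem hochschildD_snoc {n : ℕ} (h : HochschildCochain k A N (n + 1)) (b : Fin (n + 1) → A)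
    (x : A) :
    hochschildD k A N (n + 1) h (Fin.snoc b x : Fin (n + 2) → A) =
      b 0 • h (Fin.snoc (Fin.tail b) x : Fin (n + 1) → A)
      + ∑ i : Fin n, (-1 : k) ^ ((i : ℕ) + 1) •
          h (Fin.snoc (Fin.contractNth i.castSucc (· * ·) b) x : Fin (n + 1) → A)
      + (-1 : k) ^ (n + 1) • h (Fin.snoc (Fin.init b) (b (Fin.last n) * x) : Fin (n + 1) → A)
      + (-1 : k) ^ (n + 2) • (MulOpposite.op x • h b) := by
  rw [hochschildD_apply, Fin.sum_univ_castSucc]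
  simp only [Fin.contractNth_castSucc_castSucc_snoc, Fin.contractNth_castSucc_last_snoc,
    Fin.snoc_last, Fin.init_snoc, Fin.val_castSucc, Fin.val_last]
  have h0 : (Fin.snoc b x : Fin (n + 2) → A) 0 = b 0 := by
    rw [← Fin.castSucc_zero, Fin.snoc_castSucc]
  have ht : Fin.tail (Fin.snoc b x : Fin (n + 2) → A) =
      (Fin.snoc (Fin.tail b) x : Fin (n + 1) → A) := by
    funext j
    refine Fin.lastCases ?_ (fun j => ?_) j
    · simp [Fin.tail]
    · simp only [Fin.tail, Fin.snoc_castSucc, Fin.succ_castSucc]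
  rw [h0, ht]
  abel

end HochschildFormulas

section HomBimodule

variable {k : Type u} {A : Type v} [CommRing k] [CommRing A] [Algebra k A]
variable {S : Type w} {T : Type v} [CommRing S] [CommRing T] [Algebra k S] [Algebra k T]
  [Algebra S T] [IsScalarTower k S T]

/-- The `S`-linear maps `M → N` between two `T`-modules, as an `A`-bimodule through a homomorphism
`ι : A → T`: `a` acts on the left through `N` and on the right through `M`. -/
def HomBimodule (_ι : A →ₐ[k] T) (S : Type w) [CommRing S] (M N : Type v)
    [AddCommGroup M] [AddCommGroup N] [Module S M] [Module S N] : Type v :=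
  M →ₗ[S] N

namespace HomBimodule

variable (ι : A →ₐ[k] T) (M N : Type v) [AddCommGroup M] [AddCommGroup N]
  [Module S M] [Module S N] [Module T M] [Module T N] [Module k M] [Module k N]
  [IsScalarTower S T M] [IsScalarTower S T N] [IsScalarTower k T M] [IsScalarTower k T N]
  [IsScalarTower k S M] [IsScalarTower k S N]

instance : AddCommGroup (HomBimodule ι S M N) :=
  inferInstanceAs (AddCommGroup (M →ₗ[S] N))

instance : Module k (HomBimodule ι S M N) :=
  inferInstanceAs (Module k (M →ₗ[S] N))

/-- Left action: `(a • f) m = a (f m)`. -/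
instance : Module A (HomBimodule ι S M N) :=
  letI : Module T (HomBimodule ι S M N) := inferInstanceAs (Module T (M →ₗ[S] N))
  Module.compHom _ ι.toRingHom

/-- Right action: `(f • a) m = f (a m)`. -/
instance : Module Aᵐᵒᵖ (HomBimodule ι S M N) where
  smul a (f : M →ₗ[S] N) := f ∘ₗ (LinearMap.lsmul T M (ι a.unop)).restrictScalars S
  one_smul (f : M →ₗ[S] N) := LinearMap.ext fun m =>
    show f (ι 1 • m) = f m by rw [map_one, one_smul]
  mul_smul a b (f : M →ₗ[S] N) := LinearMap.ext fun m =>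
    show f (ι (b.unop * a.unop) • m) = f (ι b.unop • ι a.unop • m) by rw [map_mul, mul_smul]
  smul_zero a := LinearMap.zero_comp _
  smul_add a f g := LinearMap.add_comp _ _ _
  add_smul a b (f : M →ₗ[S] N) := LinearMap.ext fun m =>
    show f (ι (a.unop + b.unop) • m) = f (ι a.unop • m) + f (ι b.unop • m) by
      rw [map_add, add_smul, map_add]
  zero_smul (f : M →ₗ[S] N) := LinearMap.ext fun m =>
    show f (ι 0 • m) = 0 by rw [map_zero, zero_smul, map_zero]

instance : IsScalarTower k A (HomBimodule ι S M N) where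
  smul_assoc c a (f : M →ₗ[S] N) := LinearMap.ext fun m =>
    show ι (c • a) • f m = c • ι a • f m by rw [map_smul, smul_assoc]

instance : IsScalarTower k Aᵐᵒᵖ (HomBimodule ι S M N) where
  smul_assoc c a (f : M →ₗ[S] N) := LinearMap.ext fun m =>
    show f (ι (c • a.unop) • m) = c • f (ι a.unop • m) by
      rw [map_smul ι, smul_assoc, ← algebraMap_smul S c (ι a.unop • m), map_smul f, algebraMap_smul]

instance : SMulCommClass A Aᵐᵒᵖ (HomBimodule ι S M N) where
  smul_comm _ _ _ := rfl

variable {ι M N}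

/-- The linear map underlying an element of the bimodule. -/
def toLin : HomBimodule ι S M N →ₗ[k] (M →ₗ[S] N) := LinearMap.id

@[simp] theorem toLin_smul (a : A) (f : HomBimodule ι S M N) (m : M) :
    toLin (k := k) (a • f) m = ι a • toLin (k := k) f m := rfl

@[simp] theorem toLin_op_smul (a : A) (f : HomBimodule ι S M N) (m : M) :
    toLin (k := k) (MulOpposite.op a • f) m = toLin (k := k) f (ι a • m) := rfl

theorem toLin_injective : Function.Injective (toLin : HomBimodule ι S M N →ₗ[k] (M →ₗ[S] N)) :=
  fun _ _ h => h

end HomBimodule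

end HomBimodule

/-! ### The bar syzygy and its universal derivation -/

section BarSyzygy

variable {k : Type u} {A : Type v} [CommRing k] [CommRing A] [Algebra k A]
variable (S : Type w) (T : Type v) [CommRing S] [CommRing T] [Algebra k S] [Algebra k T]
  [Algebra S T] [IsScalarTower k S T]
variable (M : Type v) [AddCommGroup M] [Module S M] [Module T M] [IsScalarTower S T M]

/-- The first syzygy of a `T`-module `M` in its bar resolution relative to `S`:
the kernel of the action map `T ⊗[S] M → M`. -/
noncomputable abbrev barSyzygy : Submodule T (T ⊗[S] M) :=
  LinearMap.ker (LinearMap.liftBaseChange T (LinearMap.id : M →ₗ[S] M))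

/-- The map `(t, m) ↦ t ⊗ m - 1 ⊗ t m` with values in the syzygy. As a function of `t` it is a
one-cocycle of `T` with values in `Hom_S(M, K)` (`barD_mul`). -/
noncomputable def barD : T →ₗ[S] M →ₗ[S] barSyzygy S T M :=
  LinearMap.mk₂ S (fun t m => ⟨t ⊗ₜ m - 1 ⊗ₜ (t • m), by simp⟩)
    (fun t t' m => Subtype.ext <| by
      simp only [Submodule.coe_add, TensorProduct.add_tmul, add_smul, TensorProduct.tmul_add]; abel)
    (fun c t m => Subtype.ext <| by
      simp [smul_sub, TensorProduct.smul_tmul'])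
    (fun t m m' => Subtype.ext <| by
      simp only [Submodule.coe_add, smul_add, TensorProduct.tmul_add]; abel)
    (fun c t m => Subtype.ext <| by
      simp [smul_sub, smul_comm t c m])

variable {S T M}

@[simp] theorem coe_barD (t : T) (m : M) :
    (barD S T M t m : T ⊗[S] M) = t ⊗ₜ m - 1 ⊗ₜ (t • m) := rfl

theorem barD_mul (t t' : T) (m : M) :
    barD S T M (t * t') m = t • barD S T M t' m + barD S T M t (t' • m) := by
  refine Subtype.ext ?_
  simp [smul_sub, TensorProduct.smul_tmul', mul_smul]

theorem lift_barD_apply (z : T ⊗[S] M) :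
    (TensorProduct.lift (barD S T M) z : T ⊗[S] M) =
      z - 1 ⊗ₜ LinearMap.liftBaseChange T (LinearMap.id : M →ₗ[S] M) z := by
  induction z with
  | zero => simp
  | tmul t m => simp
  | add x y hx hy => simp only [map_add, Submodule.coe_add, hx, hy, TensorProduct.tmul_add]; abel

/-- The derivation `barD` induces an `S`-linear retraction of `T ⊗[S] M` onto the syzygy. -/
theorem lift_barD_coe (z : barSyzygy S T M) :
    TensorProduct.lift (barD S T M) (z : T ⊗[S] M) = z := by
  refine Subtype.ext ?_
  rw [lift_barD_apply, LinearMap.mem_ker.mp z.2, TensorProduct.tmul_zero, sub_zero]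

variable {N : Type v} [AddCommGroup N] [Module S N] [Module T N] [IsScalarTower S T N]
variable {ι : A →ₐ[k] T} (hι : IsBaseChange S ι.toLinearMap)

include hι in
theorem barSyzygy_hom_ext {f g : barSyzygy S T M →ₗ[S] N}
    (h : ∀ a m, f (barD S T M (ι a) m) = g (barD S T M (ι a) m)) : f = g := by
  have h1 : (barD S T M).compr₂ f = (barD S T M).compr₂ g :=
    hι.algHom_ext _ _ fun a => LinearMap.ext fun m => h a m
  refine LinearMap.ext fun z => ?_
  rw [← lift_barD_coe z]
  have h2 := congrArg (fun e => TensorProduct.lift e (z : T ⊗[S] M)) h1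
  simpa only [TensorProduct.lift_compr₂, LinearMap.comp_apply] using h2

variable [Module k M] [Module k N] [IsScalarTower k T M] [IsScalarTower k T N]
  [IsScalarTower k S M] [IsScalarTower k S N]

/-- Precomposition with `barD`. -/
noncomputable def HomBimodule.precompBarD :
    HomBimodule ι S (barSyzygy S T M) N →ₗ[k] A →ₗ[k] HomBimodule ι S M N :=
  LinearMap.mk₂ k (fun (f : barSyzygy S T M →ₗ[S] N) a =>
      (f ∘ₗ barD S T M (ι a) : M →ₗ[S] N))
    (fun (f g : barSyzygy S T M →ₗ[S] N) a => LinearMap.add_comp _ _ _)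
    (fun c (f : barSyzygy S T M →ₗ[S] N) a => LinearMap.smul_comp _ _ _)
    (fun (f : barSyzygy S T M →ₗ[S] N) a b => LinearMap.ext fun m =>
      show f (barD S T M (ι (a + b)) m) =
        f (barD S T M (ι a) m) + f (barD S T M (ι b) m) by simp)
    (fun c (f : barSyzygy S T M →ₗ[S] N) a => LinearMap.ext fun m =>
      show f (barD S T M (ι (c • a)) m) = c • f (barD S T M (ι a) m) by
        rw [map_smul, ← algebraMap_smul S c (ι a), map_smul, LinearMap.smul_apply, map_smul,
          algebraMap_smul])

theorem HomBimodule.toLin_precompBarD (f : HomBimodule ι S (barSyzygy S T M) N) (a : A) (m : M) :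
    toLin (k := k) (precompBarD f a) m = toLin (k := k) f (barD S T M (ι a) m) := rfl

theorem lift_lift_apply_barD (φ : A →ₗ[k] M →ₗ[S] N) (a : A) (m : M) :
    TensorProduct.lift (hι.lift φ) (ι a ⊗ₜ[S] m - 1 ⊗ₜ (ι a • m)) =
      φ a m - φ 1 (ι a • m) := by
  have h (b : A) : hι.lift φ (ι b) = φ b := hι.lift_eq φ b
  have h1 : hι.lift φ 1 = φ 1 := by rw [← h 1]; exact congrArg _ (map_one ι).symm
  rw [map_sub, TensorProduct.lift.tmul, TensorProduct.lift.tmul, h, h1]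

/-- Since `T` is the base change of `A`, a `k`-linear family of maps `φ a : M → N` is the same as
an `S`-linear map `ι a ⊗ m ↦ φ a m` on `T ⊗[S] M`; this is its restriction to the syzygy. -/
noncomputable def HomBimodule.ofFamily :
    (A →ₗ[k] HomBimodule ι S M N) →ₗ[k] HomBimodule ι S (barSyzygy S T M) N where
  toFun φ := (TensorProduct.lift (hι.lift (toLin ∘ₗ φ)) ∘ₗ
    (barSyzygy S T M).subtype.restrictScalars S : barSyzygy S T M →ₗ[S] N)
  map_add' φ φ' := barSyzygy_hom_ext hι fun a m => by
    change TensorProduct.lift (hι.lift (toLin ∘ₗ (φ + φ'))) (ι a ⊗ₜ[S] m - 1 ⊗ₜ (ι a • m)) =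
      TensorProduct.lift (hι.lift (toLin ∘ₗ φ)) (ι a ⊗ₜ[S] m - 1 ⊗ₜ (ι a • m)) +
      TensorProduct.lift (hι.lift (toLin ∘ₗ φ')) (ι a ⊗ₜ[S] m - 1 ⊗ₜ (ι a • m))
    simp only [lift_lift_apply_barD, LinearMap.comp_apply, LinearMap.add_apply, map_add]
    abel
  map_smul' c φ := barSyzygy_hom_ext hι fun a m => by
    change TensorProduct.lift (hι.lift (toLin ∘ₗ (c • φ))) (ι a ⊗ₜ[S] m - 1 ⊗ₜ (ι a • m)) =
      c • TensorProduct.lift (hι.lift (toLin ∘ₗ φ)) (ι a ⊗ₜ[S] m - 1 ⊗ₜ (ι a • m))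
    simp only [lift_lift_apply_barD, LinearMap.comp_apply, LinearMap.smul_apply, map_smul,
      smul_sub]

theorem HomBimodule.toLin_ofFamily (φ : A →ₗ[k] HomBimodule ι S M N) (a : A) (m : M) :
    toLin (k := k) (ofFamily hι φ) (barD S T M (ι a) m) =
      toLin (k := k) (φ a) m - toLin (k := k) (φ 1) (ι a • m) := by
  exact lift_lift_apply_barD hι (toLin ∘ₗ φ) a m

end BarSyzygy

/-! ### Dimension shifting in Hochschild cohomology -/

section DimensionShift

open HomBimodule

variable {k : Type u} {A : Type v} [CommRing k] [CommRing A] [Algebra k A]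
variable {S : Type w} {T : Type v} [CommRing S] [CommRing T] [Algebra k S] [Algebra k T]
  [Algebra S T] [IsScalarTower k S T]

/-- `HH^{n+1}(A, Hom_S(M, N)) = 0` for every `T`-module `N`. -/
def HochschildVanishing (ι : A →ₐ[k] T) (S : Type w) [CommRing S] [Algebra k S] [Algebra S T]
    (n : ℕ) (M : Type v) [AddCommGroup M] [Module S M] [Module T M] [Module k M]
    [IsScalarTower S T M] [IsScalarTower k T M] [IsScalarTower k S M] : Prop :=
  ∀ (N : Type v) [AddCommGroup N] [Module S N] [Module T N] [Module k N]
    [IsScalarTower S T N] [IsScalarTower k T N] [IsScalarTower k S N]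
    (f : HochschildCochain k A (HomBimodule ι S M N) (n + 1)),
    hochschildD k A (HomBimodule ι S M N) (n + 1) f = 0 →
      ∃ h, hochschildD k A (HomBimodule ι S M N) n h = f

variable {M : Type v} [AddCommGroup M] [Module S M] [Module T M] [Module k M]
    [IsScalarTower S T M] [IsScalarTower k T M] [IsScalarTower k S M]
variable {ι : A →ₐ[k] T}

/-- Dimension shifting: `HH^{n+2}(A, Hom_S(M, -)) = 0` implies
`HH^{n+1}(A, Hom_S(K, -)) = 0` for the syzygy `K` of `M`. -/
theorem HochschildVanishing.syzygy (hι : IsBaseChange S ι.toLinearMap) {n : ℕ}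
    (H : HochschildVanishing ι S (n + 1) M) :
    HochschildVanishing ι S n (barSyzygy S T M) := by
  intro N _ _ _ _ _ _ _ f hf
  -- the cup product of `f` with the one-cocycle `barD`
  let F : HochschildCochain k A (HomBimodule ι S M N) (n + 2) :=
    (precompBarD.compMultilinearMap f).uncurryRight
  have hF (b : Fin (n + 1) → A) (a : A) (m : M) :
      toLin (k := k) (F (Fin.snoc b a : Fin (n + 2) → A)) m =
        toLin (k := k) (f b) (barD S T M (ι a) m) := by
    simp only [F, MultilinearMap.uncurryRight_apply, Fin.init_snoc, Fin.snoc_last,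
      LinearMap.compMultilinearMap_apply, toLin_precompBarD]
  have hF0 : hochschildD k A (HomBimodule ι S M N) (n + 2) F = 0 := by
    ext a
    obtain ⟨b, x, rfl⟩ : ∃ (b : Fin (n + 2) → A) (x : A), a = (Fin.snoc b x : Fin (n + 3) → A) :=
      ⟨Fin.init a, a (Fin.last _), (Fin.snoc_init_self a).symm⟩
    refine toLin_injective (k := k) (LinearMap.ext fun m => ?_)
    have hf' := congrArg (fun e => toLin (k := k) (e b) (barD S T M (ι x) m)) hf
    have hb : F b = F (Fin.snoc (Fin.init b) (b (Fin.last (n + 1))) : Fin (n + 2) → A) := by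
      rw [Fin.snoc_init_self]
    simp only [hochschildD_apply, map_add, map_sum, map_smul, LinearMap.add_apply,
      LinearMap.sum_apply, LinearMap.smul_apply, toLin_smul, toLin_op_smul,
      _root_.zero_apply, map_zero, LinearMap.zero_apply] at hf'
    rw [hochschildD_snoc, hb]
    simp only [map_add, map_sum, map_smul, LinearMap.add_apply,
      LinearMap.sum_apply, LinearMap.smul_apply, toLin_smul, toLin_op_smul, hF,
      _root_.zero_apply, map_zero, LinearMap.zero_apply, map_mul, barD_mul]
    rw [← hf', pow_succ (-1 : k) (n + 1 + 1)]
    simp only [smul_add, mul_neg, mul_one, neg_smul]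
    abel
  obtain ⟨h, hh⟩ := H N F hF0
  refine ⟨(ofFamily hι).compMultilinearMap h.curryRight, ?_⟩
  ext b
  refine toLin_injective (k := k) (barSyzygy_hom_ext hι fun a m => ?_)
  have key (c : Fin n → A) (x : A) (m : M) :
      toLin (k := k) ((ofFamily hι).compMultilinearMap h.curryRight c) (barD S T M (ι x) m) =
        toLin (k := k) (h (Fin.snoc c x : Fin (n + 1) → A)) m -
          toLin (k := k) (h (Fin.snoc c 1 : Fin (n + 1) → A)) (ι x • m) := by
    simp only [LinearMap.compMultilinearMap_apply, toLin_ofFamily, MultilinearMap.curryRight_apply]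
  have e (x : A) (m : M) := congrArg (fun e => toLin (k := k)
    (e (Fin.snoc b x : Fin (n + 2) → A)) m) hh
  simp only [hochschildD_snoc, map_add, map_sum, map_smul, LinearMap.add_apply,
      LinearMap.sum_apply, LinearMap.smul_apply, toLin_smul, toLin_op_smul, hF] at e
  have e1 := e a m
  have e2 := e 1 (ι a • m)
  have hD1 : barD S T M (ι 1) (ι a • m) = 0 := by
    refine Subtype.ext ?_
    simp
  have hsm (u : HomBimodule ι S (barSyzygy S T M) N) (β : A) :
      toLin (k := k) u (ι β • barD S T M (ι a) m) =
        toLin (k := k) u (barD S T M (ι (β * a)) m) -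
          toLin (k := k) u (barD S T M (ι β) (ι a • m)) :=
    eq_sub_of_add_eq (by rw [← map_add, map_mul, barD_mul])
  have hmul (β : A) : ι (β * a) • m = ι β • ι a • m := by rw [map_mul, mul_smul]
  rw [hD1, map_zero] at e2
  refine Eq.trans ?_ ((congrArg₂ (· - ·) e1 e2).trans (sub_zero _))
  rw [hochschildD_apply]
  simp only [map_add, map_sum, map_smul, LinearMap.add_apply,
      LinearMap.sum_apply, LinearMap.smul_apply, toLin_smul, toLin_op_smul, hsm, key,
      map_one, one_smul, mul_one, smul_sub, Finset.sum_sub_distrib, hmul]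
  abel

/-- If `HH^1(A, Hom_S(M, -)) = 0`, then the action map `T ⊗[S] M → M` splits `T`-linearly. -/
theorem HochschildVanishing.exists_section (hι : IsBaseChange S ι.toLinearMap)
    (H : HochschildVanishing ι S 0 M) :
    ∃ σ : M →ₗ[T] T ⊗[S] M, LinearMap.liftBaseChange T (LinearMap.id : M →ₗ[S] M) ∘ₗ σ =
      LinearMap.id := by
  -- the cocycle `barD`, whose primitive corrects the `S`-linear section `m ↦ 1 ⊗ m`
  let F : HochschildCochain k A (HomBimodule ι S M (barSyzygy S T M)) 1 :=
    MultilinearMap.ofSubsingleton k A _ 0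
      (precompBarD (show HomBimodule ι S (barSyzygy S T M) (barSyzygy S T M) from
        LinearMap.id))
  have hF (a : Fin 1 → A) (m : M) : toLin (k := k) (F a) m = barD S T M (ι (a 0)) m := rfl
  have hF0 : hochschildD k A _ 1 F = 0 := by
    ext a
    refine toLin_injective (k := k) (LinearMap.ext fun m => ?_)
    have hsm : barD S T M (ι (a 0 * a 1)) m =
        ι (a 0) • barD S T M (ι (a 1)) m + barD S T M (ι (a 0)) (ι (a 1) • m) := by
      rw [map_mul, barD_mul]
    have h1 : Fin.contractNth 0 (· * ·) a 0 = a 0 * a 1 := by simp [Fin.contractNth]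
    simp only [hochschildD_apply, map_add, map_smul, LinearMap.add_apply,
      LinearMap.smul_apply, toLin_smul, toLin_op_smul, hF, Fin.tail, Fin.init,
      Fin.sum_univ_one, Fin.castSucc_zero, h1, hsm]
    refine Subtype.ext ?_
    simp only [Submodule.coe_add, Submodule.coe_smul_of_tower, Fin.val_zero,
      LinearMap.zero_apply, _root_.zero_apply, map_zero, Submodule.coe_zero,
      zero_add, pow_one, Nat.reduceAdd, even_two, Even.neg_pow, one_pow, one_smul, neg_smul]
    have key (x y : T ⊗[S] M) : x + -(x + y) + y = 0 := by abel
    exact key _ _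
  obtain ⟨h, hh⟩ := H _ F hF0
  let ρ : M →ₗ[S] barSyzygy S T M := toLin (k := k) (h default)
  have hρ (a : A) (m : M) : ι a • (ρ m : T ⊗[S] M) - (ρ (ι a • m) : T ⊗[S] M) =
      ι a ⊗ₜ m - 1 ⊗ₜ (ι a • m) := by
    have := congrArg (fun e => (barSyzygy S T M).subtype (toLin (k := k) (e (fun _ => a)) m)) hh
    simp only [hochschildD_apply, map_add, map_smul, LinearMap.add_apply, LinearMap.smul_apply,
      toLin_smul, toLin_op_smul, hF, Finset.univ_eq_empty, Finset.sum_empty, add_zero,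
      Subsingleton.elim _ (default : Fin 0 → A), Submodule.coe_smul_of_tower,
      Submodule.subtype_apply, coe_barD] at this
    rw [← this, zero_add, pow_one, neg_smul, one_smul, sub_eq_add_neg]
  let σ : M →ₗ[S] T ⊗[S] M := TensorProduct.mk S T M 1 -
    (barSyzygy S T M).subtype.restrictScalars S ∘ₗ ρ
  have hσ (m : M) : σ m = 1 ⊗ₜ m - (ρ m : T ⊗[S] M) := rfl
  have hlin (t : T) (m : M) : σ (t • m) = t • σ m := by
    have hA (a : A) (m : M) : σ (ι a • m) = ι a • σ m := by
      rw [hσ, hσ, smul_sub, TensorProduct.smul_tmul', smul_eq_mul, mul_one,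
        ← sub_eq_zero, ← sub_eq_zero.mpr (hρ a m)]
      abel
    induction t using hι.inductionOn with
    | zero => simp
    | tmul a => exact hA a m
    | smul s t ht => rw [smul_assoc, map_smul, ht, smul_assoc]
    | add t t' h h' => rw [add_smul, map_add, h, h', add_smul]
  refine ⟨{ σ with map_smul' := hlin }, LinearMap.ext fun m => ?_⟩
  change LinearMap.liftBaseChange T (LinearMap.id : M →ₗ[S] M) (1 ⊗ₜ m - (ρ m : T ⊗[S] M)) = m
  rw [map_sub, LinearMap.mem_ker.mp (ρ m).2]
  simp

end DimensionShift

/-! ### Summands of extended modules and relative dimensions -/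

section Extended

/-- `P` is a direct summand of an extended module `R ⊗[k] V`. These are the modules that are
projective relative to `k`. -/
def IsSummandOfExtended (k : Type u) (R : Type w) [CommRing k] [CommRing R] [Algebra k R]
    (P : Type v) [AddCommGroup P] [Module R P] : Prop :=
  ∃ (V : Type v) (_ : AddCommGroup V) (_ : Module k V) (i : P →ₗ[R] R ⊗[k] V)
    (p : R ⊗[k] V →ₗ[R] P), p ∘ₗ i = LinearMap.id

theorem IsSummandOfExtended.of_summand {k : Type u} {R : Type w} [CommRing k] [CommRing R]
    [Algebra k R] {P Q : Type v} [AddCommGroup P] [Module R P] [AddCommGroup Q] [Module R Q]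
    (hQ : IsSummandOfExtended k R Q) (i : P →ₗ[R] Q) (p : Q →ₗ[R] P)
    (h : p ∘ₗ i = LinearMap.id) : IsSummandOfExtended k R P := by
  obtain ⟨V, _, _, i', p', h'⟩ := hQ
  refine ⟨V, _, _, i' ∘ₗ i, p ∘ₗ p', ?_⟩
  rw [LinearMap.comp_assoc, ← LinearMap.comp_assoc i, h', LinearMap.id_comp, h]

section

variable {k : Type u} {T : Type v} [CommRing k] [CommRing T] [Algebra k T]
  {P : Type v} [AddCommGroup P] [Module T P]

theorem IsSummandOfExtended.isRelativelyProjective (hP : IsSummandOfExtended k T P) :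
    IsRelativelyProjective k T P := by
  intro X Y _ _ _ _ f ⟨s, hs, hfs⟩ g
  obtain ⟨V, _, _, i, p, hip⟩ := hP
  let _ : Module k X := Module.compHom X (algebraMap k T)
  let _ : Module k Y := Module.compHom Y (algebraMap k T)
  have _ : IsScalarTower k T X := IsScalarTower.of_algebraMap_smul fun _ _ => rfl
  have _ : IsScalarTower k T Y := IsScalarTower.of_algebraMap_smul fun _ _ => rfl
  let s' : Y →ₗ[k] X := { s with map_smul' := hs }
  let h : T ⊗[k] V →ₗ[T] X := LinearMap.liftBaseChange T
    (s' ∘ₗ (g ∘ₗ p).restrictScalars k ∘ₗ TensorProduct.mk k T V 1)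
  have hh : f ∘ₗ h = g ∘ₗ p := by
    ext v
    simp only [h, TensorProduct.AlgebraTensorModule.curry_apply, TensorProduct.curry_apply,
      LinearMap.restrictScalars_apply, LinearMap.comp_apply, LinearMap.liftBaseChange_tmul,
      one_smul, TensorProduct.mk_apply]
    exact hfs _
  refine ⟨h ∘ₗ i, ?_⟩
  rw [← LinearMap.comp_assoc, hh, LinearMap.comp_assoc, hip, LinearMap.comp_id]

theorem IsSummandOfExtended.isRelativelyFlat (hP : IsSummandOfExtended k T P) :
    IsRelativelyFlat k T P := by
  intro X Y _ _ _ _ f ⟨r, hr, hrf⟩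
  obtain ⟨V, _, _, i, p, hip⟩ := hP
  let _ : Module k X := Module.compHom X (algebraMap k T)
  let _ : Module k Y := Module.compHom Y (algebraMap k T)
  have _ : IsScalarTower k T X := IsScalarTower.of_algebraMap_smul fun _ _ => rfl
  have _ : IsScalarTower k T Y := IsScalarTower.of_algebraMap_smul fun _ _ => rfl
  let r' : Y →ₗ[k] X := { r with map_smul' := hr }
  have hrf' : r' ∘ₗ f.restrictScalars k = LinearMap.id := LinearMap.ext hrf
  have h1 : Function.Injective ((f.restrictScalars k).rTensor V) := by
    refine Function.LeftInverse.injective (g := r'.rTensor V) fun z => ?_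
    rw [← LinearMap.comp_apply, ← LinearMap.rTensor_comp, hrf', LinearMap.rTensor_id]
    rfl
  let eX := TensorProduct.AlgebraTensorModule.cancelBaseChange k T T X V
  let eY := TensorProduct.AlgebraTensorModule.cancelBaseChange k T T Y V
  have h2 (z) : eY (f.rTensor (T ⊗[k] V) z) = (f.restrictScalars k).rTensor V (eX z) := by
    induction z with
    | zero => simp
    | add a b ha hb => simp only [map_add, ha, hb]
    | tmul x w =>
      induction w with
      | zero => simp
      | add a b ha hb => simp only [TensorProduct.tmul_add, map_add, ha, hb]
      | tmul t v => simp [eX, eY]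
  have h3 : Function.Injective (f.rTensor (T ⊗[k] V)) := fun a b hab => by
    refine eX.injective (h1 ?_)
    rw [← h2, ← h2, hab]
  rw [LinearMap.lTensor_inj_iff_rTensor_inj]
  have h4 : Function.Injective (i.lTensor X) := by
    refine Function.LeftInverse.injective (g := p.lTensor X) fun z => ?_
    rw [← LinearMap.comp_apply, ← LinearMap.lTensor_comp, hip, LinearMap.lTensor_id]
    rfl
  refine Function.Injective.of_comp (f := i.lTensor Y) ?_
  rw [← LinearMap.coe_comp, LinearMap.lTensor_comp_rTensor, ← LinearMap.rTensor_comp_lTensor,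
    LinearMap.coe_comp]
  exact h3.comp h4

end

variable {k : Type u} {A : Type v} [CommRing k] [CommRing A] [Algebra k A]
variable {S : Type w} {T : Type v} [CommRing S] [CommRing T] [Algebra k S] [Algebra k T]
  [Algebra S T] [IsScalarTower k S T]
variable {M : Type v} [AddCommGroup M] [Module S M]

theorem IsSummandOfExtended.baseChange (hM : IsSummandOfExtended k S M) :
    IsSummandOfExtended k T (T ⊗[S] M) := by
  obtain ⟨V, _, _, i, p, hip⟩ := hM
  let e := TensorProduct.AlgebraTensorModule.cancelBaseChange k S T T V
  refine ⟨V, _, _, e.toLinearMap ∘ₗ i.baseChange T, p.baseChange T ∘ₗ e.symm.toLinearMap, ?_⟩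
  refine LinearMap.ext fun z => ?_
  simp only [LinearMap.comp_apply, LinearEquiv.coe_coe, LinearEquiv.symm_apply_apply]
  rw [← LinearMap.comp_apply, ← LinearMap.baseChange_comp, hip, LinearMap.baseChange_id]

theorem IsSummandOfExtended.restrictScalars {ι : A →ₐ[k] T} (hι : IsBaseChange S ι.toLinearMap)
    [Module T M] [IsScalarTower S T M] (hM : IsSummandOfExtended k T M) :
    IsSummandOfExtended k S M := by
  obtain ⟨V, _, _, i, p, hip⟩ := hM
  let e : T ⊗[k] V ≃ₗ[S] S ⊗[k] (A ⊗[k] V) :=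
    (TensorProduct.AlgebraTensorModule.congr hι.equiv.symm (LinearEquiv.refl k V)).trans
      (TensorProduct.AlgebraTensorModule.assoc k k S S A V)
  refine ⟨A ⊗[k] V, _, _, e.toLinearMap ∘ₗ i.restrictScalars S,
    p.restrictScalars S ∘ₗ e.symm.toLinearMap, ?_⟩
  refine LinearMap.ext fun z => ?_
  simpa using LinearMap.congr_fun hip z

variable [Module T M] [IsScalarTower S T M]

theorem IsSummandOfExtended.syzygy {ι : A →ₐ[k] T} (hι : IsBaseChange S ι.toLinearMap)
    (hM : IsSummandOfExtended k S M) : IsSummandOfExtended k S (barSyzygy S T M) :=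
  (hM.baseChange (T := T) |>.restrictScalars hι).of_summand
    ((barSyzygy S T M).subtype.restrictScalars S) (TensorProduct.lift (barD S T M))
    (LinearMap.ext lift_barD_coe)

theorem isSplitSurjectionOver_liftBaseChange :
    IsSplitSurjectionOver k (LinearMap.liftBaseChange T (LinearMap.id : M →ₗ[S] M)) := by
  refine ⟨(TensorProduct.mk S T M 1).toAddMonoidHom, fun c m => ?_, fun m => ?_⟩
  · change 1 ⊗ₜ[S] (algebraMap k T c • m) = algebraMap k T c • (1 ⊗ₜ[S] m)
    rw [IsScalarTower.algebraMap_apply k S T, algebraMap_smul T (algebraMap k S c) m,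
      algebraMap_smul T (algebraMap k S c), TensorProduct.tmul_smul]
  · change LinearMap.liftBaseChange T (LinearMap.id : M →ₗ[S] M) (1 ⊗ₜ[S] m) = m
    simp

/-- The vanishing of `HH^{n+1}(A, Hom_S(M, -))` bounds the `k`-relative dimensions of `M` over
`T` by `n`: the successive bar syzygies resolve `M`, and the `n`-th one is relatively
projective because its action map splits. -/
theorem HochschildVanishing.hasRelativeDimensionLE {ι : A →ₐ[k] T}
    (hι : IsBaseChange S ι.toLinearMap) {n : ℕ} [Module k M] [IsScalarTower k T M]
    [IsScalarTower k S M] (H : HochschildVanishing ι S n M) (hM : IsSummandOfExtended k S M) :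
    HasRelativeProjectiveDimensionLE k T n M ∧ HasRelativeFlatDimensionLE k T n M := by
  induction n generalizing M with
  | zero =>
    obtain ⟨σ, hσ⟩ := H.exists_section hι
    have := (hM.baseChange (T := T)).of_summand σ _ hσ
    exact ⟨this.isRelativelyProjective, this.isRelativelyFlat⟩
  | succ n ih =>
    have h := ih (H.syzygy hι) (hM.syzygy hι)
    have hT := hM.baseChange (T := T)
    exact ⟨⟨T ⊗[S] M, _, _, _, hT.isRelativelyProjective,
        isSplitSurjectionOver_liftBaseChange, h.1⟩,
      ⟨T ⊗[S] M, _, _, _, hT.isRelativelyFlat, isSplitSurjectionOver_liftBaseChange, h.2⟩⟩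

end Extended

/-! ### Cohomological dimension bounds the relative dimensions -/

section CohomologicalDimension

variable (k : Type u) (A : Type v) [CommRing k] [CommRing A] [Algebra k A]

/-- `HH^n(A, N) = 0` for all `A`-bimodules `N` in the universe of `A`, phrased as: every cocycle is
a coboundary. -/
def HochschildCohomologyVanishes (n : ℕ) : Prop :=
  ∀ (N : Type v) [AddCommGroup N] [Module k N] [Module A N] [Module Aᵐᵒᵖ N] [IsScalarTower k A N]
    [IsScalarTower k Aᵐᵒᵖ N] [SMulCommClass A Aᵐᵒᵖ N] (f : HochschildCochain k A N n),
    hochschildD k A N n f = 0 → f ∈ hochschildCoboundaries k A N n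

variable {k A}

theorem hochschildCohomologyVanishes_of_HCHDim_lt {n : ℕ} (h : HCHDim k A < n) :
    HochschildCohomologyVanishes k A n := by
  intro N _ _ _ _ _ _ _ f hf
  by_contra hfN
  refine h.not_ge (le_iSup₂_of_le n ⟨N, _, _, _, _, inferInstance, inferInstance, inferInstance,
    ?_⟩ le_rfl)
  rw [Submodule.Quotient.nontrivial_iff]
  intro htop
  have : (⟨f, hf⟩ : LinearMap.ker (hochschildD k A N n)) ∈
      (hochschildCoboundaries k A N n).comap (LinearMap.ker (hochschildD k A N n)).subtype :=
    htop ▸ Submodule.mem_top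
  exact hfN this

theorem HochschildCohomologyVanishes.hochschildVanishing {n : ℕ}
    (H : HochschildCohomologyVanishes k A (n + 1)) {S : Type w} {T : Type v} [CommRing S]
    [CommRing T] [Algebra k S] [Algebra k T] [Algebra S T] [IsScalarTower k S T] (ι : A →ₐ[k] T)
    (M : Type v) [AddCommGroup M] [Module S M] [Module T M] [Module k M]
    [IsScalarTower S T M] [IsScalarTower k T M] [IsScalarTower k S M] :
    HochschildVanishing ι S n M := by
  intro N _ _ _ _ _ _ _ f hf
  exact H _ f hf

/-- The case `S = k`, `T = A`, in which every `M` is extended over `S`. -/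
theorem HochschildCohomologyVanishes.hasRelativeDimensionLE {n : ℕ}
    (H : HochschildCohomologyVanishes k A (n + 1)) (M : Type v) [AddCommGroup M] [Module A M] :
    HasRelativeProjectiveDimensionLE k A n M ∧ HasRelativeFlatDimensionLE k A n M := by
  let _ : Module k M := Module.compHom M (algebraMap k A)
  have _ : IsScalarTower k A M := IsScalarTower.of_algebraMap_smul fun _ _ => rfl
  have hι : IsBaseChange k (AlgHom.id k A).toLinearMap :=
    IsBaseChange.ofEquiv (LinearEquiv.refl k A)
  refine (H.hochschildVanishing (S := k) (AlgHom.id k A) M).hasRelativeDimensionLE hι ?_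
  exact ⟨M, _, _, (TensorProduct.lid k M).symm.toLinearMap, (TensorProduct.lid k M).toLinearMap,
    LinearMap.ext fun m => by simp⟩

/-- The case `S = A`, `T = A ⊗[k] A`, `M = A`. Here `S` is the left factor of `T` and `ι` the
inclusion of the right factor. -/
theorem HochschildCohomologyVanishes.hasRelativeDimensionLE_diagonalBimodule {n : ℕ}
    (H : HochschildCohomologyVanishes k A (n + 1)) :
    HasRelativeProjectiveDimensionLE k (A ⊗[k] A) n (diagonalBimodule k A) := by
  let inst : Module (A ⊗[k] A) A :=
    Module.compHom A (Algebra.TensorProduct.lmul' k : A ⊗[k] A →ₐ[k] A).toRingHom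
  have hsm (t : A ⊗[k] A) (m : A) : t • m = Algebra.TensorProduct.lmul' k t * m := rfl
  have _ : IsScalarTower A (A ⊗[k] A) A := IsScalarTower.of_algebraMap_smul fun a m => by
    simp [hsm]
  have _ : IsScalarTower k (A ⊗[k] A) A := IsScalarTower.of_algebraMap_smul fun a m => by
    rw [hsm, AlgHom.commutes, Algebra.smul_def]
  have hι : IsBaseChange A
      (Algebra.TensorProduct.includeRight : A →ₐ[k] A ⊗[k] A).toLinearMap :=
    TensorProduct.isBaseChange k A A
  -- `A` is a summand of `A ⊗[k] A` through `a ↦ a ⊗ 1` and multiplication; `A ⊗[k] k` would not do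
  -- because `k` may live in another universe
  have hA : IsSummandOfExtended k A A :=
    ⟨A, inferInstance, inferInstance, LinearMap.toSpanSingleton A _ (1 ⊗ₜ 1),
      (Algebra.TensorProduct.lmul'' k (S := A)).toLinearMap,
      LinearMap.ext_ring (by simp [← Algebra.TensorProduct.one_def])⟩
  exact ((H.hochschildVanishing (S := A)
    (Algebra.TensorProduct.includeRight : A →ₐ[k] A ⊗[k] A) A).hasRelativeDimensionLE hι hA).1

end CohomologicalDimension

/-! ### Absolute dimensions over a field -/

section FieldBase

open CategoryTheory

variable {k : Type u} {A : Type v} [Field k] [CommRing A] [Algebra k A]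

theorem isSplitSurjectionOver_of_surjective {X Y : Type v} [AddCommGroup X] [Module A X]
    [AddCommGroup Y] [Module A Y] (f : X →ₗ[A] Y) (hf : Function.Surjective f) :
    IsSplitSurjectionOver k f := by
  let _ : Module k X := Module.compHom X (algebraMap k A)
  let _ : Module k Y := Module.compHom Y (algebraMap k A)
  have _ : IsScalarTower k A X := IsScalarTower.of_algebraMap_smul fun _ _ => rfl
  have _ : IsScalarTower k A Y := IsScalarTower.of_algebraMap_smul fun _ _ => rfl
  obtain ⟨s, hs⟩ := (f.restrictScalars k).exists_rightInverse_of_surjective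
    (LinearMap.range_eq_top.mpr hf)
  exact ⟨s.toAddMonoidHom, s.map_smul, LinearMap.congr_fun hs⟩

theorem isSplitInjectionOver_of_injective {X Y : Type v} [AddCommGroup X] [Module A X]
    [AddCommGroup Y] [Module A Y] (f : X →ₗ[A] Y) (hf : Function.Injective f) :
    IsSplitInjectionOver k f := by
  let _ : Module k X := Module.compHom X (algebraMap k A)
  let _ : Module k Y := Module.compHom Y (algebraMap k A)
  have _ : IsScalarTower k A X := IsScalarTower.of_algebraMap_smul fun _ _ => rfl
  have _ : IsScalarTower k A Y := IsScalarTower.of_algebraMap_smul fun _ _ => rfl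
  obtain ⟨r, hr⟩ := (f.restrictScalars k).exists_leftInverse_of_injective
    (LinearMap.ker_eq_bot.mpr hf)
  exact ⟨r.toAddMonoidHom, r.map_smul, LinearMap.congr_fun hr⟩

theorem IsRelativelyFlat.flat {P : Type v} [AddCommGroup P] [Module A P]
    (hP : IsRelativelyFlat k A P) : Module.Flat A P :=
  Module.Flat.iff_lTensor_preserves_injective_linearMap.mpr fun _ _ _ _ _ _ f hf =>
    hP _ _ f (isSplitInjectionOver_of_injective f hf)

theorem IsRelativelyProjective.projective {P : Type v} [AddCommGroup P] [Module A P]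
    (hP : IsRelativelyProjective k A P) : Module.Projective A P :=
  Module.Projective.of_lifting_property fun f g hf =>
    hP _ _ f (isSplitSurjectionOver_of_surjective f hf) g

theorem IsSplitSurjectionOver.surjective {k : Type u} [CommRing k] [Algebra k A] {X Y : Type v}
    [AddCommGroup X] [Module A X] [AddCommGroup Y] [Module A Y] {f : X →ₗ[A] Y}
    (hf : IsSplitSurjectionOver k f) : Function.Surjective f :=
  let ⟨s, _, hs⟩ := hf
  fun y => ⟨s y, hs y⟩

theorem HasRelativeFlatDimensionLE.hasFlatDimensionLE {n : ℕ} {M : Type v} [AddCommGroup M]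
    [Module A M] (h : HasRelativeFlatDimensionLE k A n M) : HasFlatDimensionLE A n M := by
  induction n generalizing M with
  | zero => exact IsRelativelyFlat.flat (k := k) h
  | succ n ih =>
    obtain ⟨F, _, _, f, hF, hf, hK⟩ := h
    exact ⟨F, _, _, f, hF.flat, hf.surjective, ih hK⟩

theorem HasRelativeProjectiveDimensionLE.hasProjectiveDimensionLE {n : ℕ} {M : Type v}
    [AddCommGroup M] [Module A M] (h : HasRelativeProjectiveDimensionLE k A n M) :
    HasProjectiveDimensionLE (ModuleCat.of A M) n := by
  induction n generalizing M with
  | zero =>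
    have := IsRelativelyProjective.projective (k := k) h
    exact (projective_iff_hasProjectiveDimensionLE_zero _).mp inferInstance
  | succ n ih =>
    obtain ⟨P, _, _, f, hP, hf, hK⟩ := h
    have := hP.projective
    have hS := LinearMap.shortExact_shortComplexKer hf.surjective
    have hproj : Projective f.shortComplexKer.X₂ := inferInstanceAs (Projective (ModuleCat.of A P))
    exact (hS.hasProjectiveDimensionLT_X₃_iff n hproj).mpr (ih hK)

end FieldBase

section Bounds

variable {k : Type u} {A : Type v} [CommRing k] [CommRing A] [Algebra k A]

theorem HochschildCohomologyVanishes.relativeWeakDimension_le {n : ℕ}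
    (H : HochschildCohomologyVanishes k A (n + 1)) : relativeWeakDimension k A ≤ n :=
  iSup_le fun M => iInf₂_le n (H.hasRelativeDimensionLE M).2

theorem HochschildCohomologyVanishes.relativeGlobalProjectiveDimension_le {n : ℕ}
    (H : HochschildCohomologyVanishes k A (n + 1)) : relativeGlobalProjectiveDimension k A ≤ n :=
  iSup_le fun M => iInf₂_le n (H.hasRelativeDimensionLE M).1

/-- A bound by every `n` for which `HH^{n+1}(A, -)` vanishes is a bound by `HCHDim k A`: if the
latter is finite, it is such an `n` itself. -/
theorem le_HCHDim_of_forall {x : WithBot ℕ∞}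
    (h : ∀ n : ℕ, HochschildCohomologyVanishes k A (n + 1) → x ≤ (n : WithBot ℕ∞)) :
    x ≤ (HCHDim k A : WithBot ℕ∞) := by
  cases hd : HCHDim k A with
  | top => exact le_top
  | coe n =>
    refine h n (hochschildCohomologyVanishes_of_HCHDim_lt ?_)
    rw [hd]
    exact_mod_cast Nat.lt_succ_self n

end Bounds

section FieldBounds

open CategoryTheory

variable {k : Type u} {A : Type v} [Field k] [CommRing A] [Algebra k A]

theorem HochschildCohomologyVanishes.weakDimension_le {n : ℕ}
    (H : HochschildCohomologyVanishes k A (n + 1)) : weakDimension A ≤ n :=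
  iSup_le fun M => iInf₂_le n (H.hasRelativeDimensionLE M).2.hasFlatDimensionLE

theorem HochschildCohomologyVanishes.globalProjectiveDimension_le {n : ℕ}
    (H : HochschildCohomologyVanishes k A (n + 1)) :
    globalProjectiveDimension A ≤ (n : WithBot ℕ∞) :=
  iSup_le fun M => (projectiveDimension_le_iff _ n).mpr
    (H.hasRelativeDimensionLE M).1.hasProjectiveDimensionLE

theorem HochschildCohomologyVanishes.projectiveDimension_diagonalBimodule_le {n : ℕ}
    (H : HochschildCohomologyVanishes k A (n + 1)) :
    projectiveDimension (diagonalBimodule k A) ≤ (n : WithBot ℕ∞) :=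
  (projectiveDimension_le_iff _ n).mpr
    H.hasRelativeDimensionLE_diagonalBimodule.hasProjectiveDimensionLE

end FieldBounds

/-! ### Quasi-free algebras have vanishing second Hochschild cohomology -/

section SquareZero

variable {k : Type u} {A : Type v} [CommRing k] [Ring A] [Algebra k A]
variable {N : Type v} [AddCommGroup N] [Module k N] [Module A N] [Module Aᵐᵒᵖ N]
  [IsScalarTower k A N] [IsScalarTower k Aᵐᵒᵖ N] [SMulCommClass A Aᵐᵒᵖ N]

open MulOpposite

/-- The extension of `A` by the square-zero ideal `N` whose multiplication
`(a, x) (b, y) = (a b, a y + x b + f(a, b))` is twisted by a two-cochain `f`. -/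
def TwistedExtension (_f : HochschildCochain k A N 2) : Type v := A × N

namespace TwistedExtension

theorem update_two_zero (a b x : A) : Function.update ![a, b] 0 x = ![x, b] := by
  ext i; fin_cases i <;> rfl

theorem update_two_one (a b x : A) : Function.update ![a, b] 1 x = ![a, x] := by
  ext i; fin_cases i <;> rfl

theorem cochain_two_add_left (f : HochschildCochain k A N 2) (a a' b : A) :
    f ![a + a', b] = f ![a, b] + f ![a', b] := by
  simpa only [update_two_zero] using f.map_update_add ![a, b] 0 a a'

theorem cochain_two_add_right (f : HochschildCochain k A N 2) (a b b' : A) :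
    f ![a, b + b'] = f ![a, b] + f ![a, b'] := by
  simpa only [update_two_one] using f.map_update_add ![a, b] 1 b b'

theorem cochain_two_smul_left (f : HochschildCochain k A N 2) (c : k) (a b : A) :
    f ![c • a, b] = c • f ![a, b] := by
  simpa only [update_two_zero] using f.map_update_smul ![a, b] 0 c a

theorem cochain_two_smul_right (f : HochschildCochain k A N 2) (c : k) (a b : A) :
    f ![a, c • b] = c • f ![a, b] := by
  simpa only [update_two_one] using f.map_update_smul ![a, b] 1 c b

/-- The cocycle condition in degree two. -/
theorem cocycle_two {f : HochschildCochain k A N 2} (hf : hochschildD k A N 2 f = 0) (a b c : A) :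
    a • f ![b, c] + f ![a, b * c] = f ![a * b, c] + op c • f ![a, b] := by
  have h := congrArg (fun e => e ![a, b, c]) hf
  have h0 : Fin.contractNth (Fin.castSucc 0) (· * ·) ![a, b, c] = ![a * b, c] := by
    ext i; fin_cases i <;> simp [Fin.contractNth]
  have h1 : Fin.contractNth (Fin.castSucc 1) (· * ·) ![a, b, c] = ![a, b * c] := by
    ext i; fin_cases i <;> simp [Fin.contractNth]
  have h2 : Fin.init ![a, b, c] = ![a, b] := by
    ext i; fin_cases i <;> simp [Fin.init]
  have h3 : Fin.tail ![a, b, c] = ![b, c] := rfl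
  have h4 : ![a, b, c] (Fin.last 2) = c := rfl
  simp only [hochschildD_apply, Fin.sum_univ_two, h0, h1, h2, h3, h4] at h
  simp only [Matrix.cons_val_zero, Fin.val_zero, Fin.val_one, _root_.zero_apply] at h
  norm_num at h
  rw [← sub_eq_zero, ← h]
  abel

variable (f : HochschildCochain k A N 2)

instance : AddCommGroup (TwistedExtension f) := inferInstanceAs (AddCommGroup (A × N))

instance : Module k (TwistedExtension f) := inferInstanceAs (Module k (A × N))

variable {f}

/-- The ring structure on the twisted extension; associativity is the cocycle condition, and the
unit is `(1, -f(1, 1))`. -/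
abbrev ringOfCocycle (hf : hochschildD k A N 2 f = 0) : Ring (TwistedExtension f) where
  __ := (inferInstance : AddCommGroup (TwistedExtension f))
  mul x y := (x.1 * y.1, x.1 • y.2 + op y.1 • x.2 + f ![x.1, y.1])
  one := (1, - f ![1, 1])
  left_distrib x y z := Prod.ext (mul_add x.1 y.1 z.1) <| by
    change x.1 • (y.2 + z.2) + op (y.1 + z.1) • x.2 + f ![x.1, y.1 + z.1] =
      x.1 • y.2 + op y.1 • x.2 + f ![x.1, y.1] + (x.1 • z.2 + op z.1 • x.2 + f ![x.1, z.1])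
    rw [cochain_two_add_right, smul_add, op_add, add_smul]
    abel
  right_distrib x y z := Prod.ext (add_mul x.1 y.1 z.1) <| by
    change (x.1 + y.1) • z.2 + op z.1 • (x.2 + y.2) + f ![x.1 + y.1, z.1] =
      x.1 • z.2 + op z.1 • x.2 + f ![x.1, z.1] + (y.1 • z.2 + op z.1 • y.2 + f ![y.1, z.1])
    rw [cochain_two_add_left, smul_add, add_smul]
    abel
  zero_mul x := Prod.ext (zero_mul x.1) <| by
    change (0 : A) • x.2 + op x.1 • (0 : N) + f ![0, x.1] = 0
    have := cochain_two_smul_left f 0 0 x.1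
    simpa using this
  mul_zero x := Prod.ext (mul_zero x.1) <| by
    change x.1 • (0 : N) + op (0 : A) • x.2 + f ![x.1, 0] = 0
    have := cochain_two_smul_right f 0 x.1 0
    simpa using this
  one_mul x := Prod.ext (one_mul x.1) <| by
    change (1 : A) • x.2 + op x.1 • (- f ![1, 1]) + f ![1, x.1] = x.2
    have := cocycle_two hf 1 1 x.1
    simp only [one_smul, one_mul, mul_one] at this
    rw [add_left_cancel this]
    simp
  mul_one x := Prod.ext (mul_one x.1) <| by
    change x.1 • (- f ![1, 1]) + op (1 : A) • x.2 + f ![x.1, 1] = x.2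
    have := cocycle_two hf x.1 1 1
    simp only [op_one, one_smul, mul_one] at this
    rw [add_comm (f ![x.1, 1])] at this
    rw [← add_right_cancel this]
    simp
  mul_assoc x y z := Prod.ext (mul_assoc x.1 y.1 z.1) <| by
    change (x.1 * y.1) • z.2 + op z.1 • (x.1 • y.2 + op y.1 • x.2 + f ![x.1, y.1]) +
        f ![x.1 * y.1, z.1] =
      x.1 • (y.1 • z.2 + op z.1 • y.2 + f ![y.1, z.1]) + op (y.1 * z.1) • x.2 +
        f ![x.1, y.1 * z.1]
    have := cocycle_two hf x.1 y.1 z.1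
    simp only [smul_add, op_mul, mul_smul, ← smul_comm x.1 (op z.1) y.2]
    rw [← sub_eq_zero] at this ⊢
    rw [← neg_eq_zero, ← this]
    abel

end TwistedExtension

open TwistedExtension in
/-- An algebra section of the extension twisted by `f` has a second component whose negative is a
primitive of `f`. -/
theorem IsQuasiFree.hochschildCoboundary (hA : IsQuasiFree k A) (f : HochschildCochain k A N 2)
    (hf : hochschildD k A N 2 f = 0) : ∃ h, hochschildD k A N 1 h = f := by
  let _ := TwistedExtension.ringOfCocycle hf
  have hmul (x y : TwistedExtension f) :
      x * y = (x.1 * y.1, x.1 • y.2 + op y.1 • x.2 + f ![x.1, y.1]) := rfl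
  let _ : Algebra k (TwistedExtension f) := Algebra.ofModule
    (fun c x y => Prod.ext (smul_mul_assoc c x.1 y.1) <| by
      change (c • x.1) • y.2 + op y.1 • (c • x.2) + f ![c • x.1, y.1] =
        c • (x.1 • y.2 + op y.1 • x.2 + f ![x.1, y.1])
      rw [cochain_two_smul_left, smul_add, smul_add, smul_assoc, smul_comm c (op y.1)])
    (fun c x y => Prod.ext (mul_smul_comm c x.1 y.1) <| by
      change x.1 • (c • y.2) + op (c • y.1) • x.2 + f ![x.1, c • y.1] =
        c • (x.1 • y.2 + op y.1 • x.2 + f ![x.1, y.1])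
      rw [cochain_two_smul_right, smul_add, smul_add, op_smul, smul_assoc, smul_comm c x.1])
  let p : TwistedExtension f →ₐ[k] A := AlgHom.ofLinearMap (LinearMap.fst k A N) rfl fun _ _ => rfl
  obtain ⟨s, hs⟩ := hA (TwistedExtension f) A p (fun a => ⟨(a, 0), rfl⟩)
    (fun x y hx hy => by
      have hx' : x.1 = 0 := hx
      have hy' : y.1 = 0 := hy
      have h0 := cochain_two_smul_left f 0 0 0
      rw [hmul, hx', hy']
      simp only [zero_smul] at h0
      simp [h0]
      rfl) (AlgHom.id k A)
  have hs1 (a : A) : (s a).1 = a := DFunLike.congr_fun hs a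
  let h : A →ₗ[k] N := - (LinearMap.snd k A N ∘ₗ s.toLinearMap)
  have hh (a b : A) : a • h b - h (a * b) + op b • h a = f ![a, b] := by
    have := congrArg Prod.snd ((map_mul s a b).trans (hmul _ _))
    change (s (a * b)).2 = (s a).1 • (s b).2 + op (s b).1 • (s a).2 + f ![(s a).1, (s b).1] at this
    rw [hs1, hs1] at this
    change a • (-(s b).2) - (-(s (a * b)).2) + op b • (-(s a).2) = _
    rw [this, smul_neg, smul_neg]
    abel
  refine ⟨MultilinearMap.ofSubsingleton k A N 0 h, ?_⟩
  ext a
  have ha : a = ![a 0, a 1] := by ext i; fin_cases i <;> rfl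
  have h1 : Fin.contractNth 0 (· * ·) a 0 = a 0 * a 1 := by simp [Fin.contractNth]
  rw [hochschildD_apply, congrArg f ha, ← hh]
  simp [Fin.tail, Fin.init, h1, sub_eq_add_neg]

end SquareZero

theorem IsQuasiFree.hochschildCohomologyVanishes {k : Type u} {A : Type v} [CommRing k]
    [CommRing A] [Algebra k A] (hA : IsQuasiFree k A) : HochschildCohomologyVanishes k A 2 :=
  fun _ _ _ _ _ _ _ _ f hf => hA.hochschildCoboundary f hf

/-! ### Regular sequences and nonvanishing Ext -/

section RegularSequence

open CategoryTheory Abelian RingTheory.Sequence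
open scoped Pointwise

variable {A : Type v} [CommRing A] (S : Submonoid A) {R : Type v} [CommRing R] [Algebra A R]
  [IsLocalization S R]

include S in
/-- If `r ∈ S⁻¹A` kills `N`, then multiplication by `r` on an `S⁻¹A`-module `M` induces zero on
`Ext_A(M, N)`: writing `r = a / s`, it is `a` times the map induced by `1 / s`, and `a` kills
`N`. -/
theorem ext_comp_lsmul_eq_zero {M N : Type v} [AddCommGroup M] [AddCommGroup N]
    [Module R M] [Module R N] [Module A M] [Module A N] [IsScalarTower A R M]
    [IsScalarTower A R N] {r : R} (hr : ∀ x : N, r • x = 0) {n : ℕ}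
    (e : Ext.{v} (ModuleCat.of A M) (ModuleCat.of A N) n) :
    (Ext.mk₀ (ModuleCat.ofHom ((LinearMap.lsmul R M r).restrictScalars A))).comp e (zero_add n) =
      0 := by
  obtain ⟨a, s, rfl⟩ := IsLocalization.exists_mk'_eq S r
  have ha : a • 𝟙 (ModuleCat.of A N) = 0 := by
    ext x
    change a • x = 0
    rw [← algebraMap_smul R a x, ← IsLocalization.mk'_spec R a s, mul_comm, mul_smul, hr, smul_zero]
  have hf : ModuleCat.ofHom ((LinearMap.lsmul R M (IsLocalization.mk' R a s)).restrictScalars A) =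
      a • ModuleCat.ofHom ((LinearMap.lsmul R M (IsLocalization.mk' R 1 s)).restrictScalars A) := by
    ext x
    change IsLocalization.mk' R a s • x = a • IsLocalization.mk' R 1 s • x
    rw [← smul_assoc, IsLocalization.smul_mk'_one]
  rw [hf, Ext.mk₀_smul, Ext.smul_comp, ← Ext.comp_smul, Ext.smul_eq_comp_mk₀, ha, Ext.mk₀_zero,
    Ext.comp_zero, Ext.comp_zero]

include S in
/-- Dividing `M` by a regular element of the annihilator of `N` raises by one the degree in which
`Ext_A(M, N)` is nonzero. -/
theorem exists_ext_ne_zero_of_isWeaklyRegular {N : Type v} [AddCommGroup N] [Module R N]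
    [Module A N] [IsScalarTower A R N] (rs : List R) (hN : ∀ r ∈ rs, ∀ x : N, r • x = 0)
    {M : Type v} [AddCommGroup M] [Module R M] [Module A M] [IsScalarTower A R M]
    (hM : IsWeaklyRegular M rs) {n : ℕ} (e : Ext.{v} (ModuleCat.of A M) (ModuleCat.of A N) n)
    (he : e ≠ 0) :
    ∃ (X : ModuleCat.{v} A) (e' : Ext.{v} X (ModuleCat.of A N) (n + rs.length)), e' ≠ 0 := by
  induction rs generalizing M n with
  | nil => exact ⟨_, e, he⟩
  | cons r rs ih =>
    rw [isWeaklyRegular_cons_iff] at hM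
    have hex := LinearMap.exact_lsmul_mkQ_smul_top M r
    let μ : M →ₗ[A] M := (LinearMap.lsmul R M r).restrictScalars A
    let π : M →ₗ[A] QuotSMulTop r M :=
      (Submodule.mkQ (r • (⊤ : Submodule R M))).restrictScalars A
    have hex : Function.Exact μ π := LinearMap.exact_lsmul_mkQ_smul_top M r
    have hπ : Function.Surjective π := Submodule.Quotient.mk_surjective _
    let C : ShortComplex (ModuleCat.{v} A) :=
      ModuleCat.shortComplexOfCompEqZero μ π hex.linearMap_comp_eq_zero
    have hC : C.ShortExact := ModuleCat.shortComplex_shortExact C hex hM.1 hπ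
    have he' : hC.extClass.comp e (add_comm 1 n) ≠ 0 := fun h0 => by
      obtain ⟨x, hx⟩ := Ext.contravariant_sequence_exact₁ hC _ e (add_comm 1 n) h0
      exact he (hx.symm.trans
        (ext_comp_lsmul_eq_zero S (hN r List.mem_cons_self) x))
    obtain ⟨X, e', h⟩ := ih (M := QuotSMulTop r M) (fun r hr => hN r (List.mem_cons_of_mem _ hr))
      hM.2 _ he'
    refine ⟨X, ?_⟩
    rw [List.length_cons, add_comm rs.length, ← add_assoc]
    exact ⟨e', h⟩

include S in
/-- A regular sequence in a localization of `A` is at most as long as the global dimension of `A`: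
start from the quotient map `R → R / (rs)` as a nonzero class in degree zero. -/
theorem length_le_of_isRegular_of_globalProjectiveDimension_le {rs : List R} (hrs : IsRegular R rs)
    {d : ℕ} (hd : globalProjectiveDimension A ≤ (d : WithBot ℕ∞)) : rs.length ≤ d := by
  by_contra! hlt
  have hnt : Nontrivial (R ⧸ Ideal.ofList rs) := by
    refine Ideal.Quotient.nontrivial_iff.mpr fun h => hrs.top_ne_smul ?_
    rw [h]
    simp
  let g : R →ₗ[A] R ⧸ Ideal.ofList rs := (Submodule.mkQ (Ideal.ofList rs)).restrictScalars A
  have hg : Ext.mk₀.{v} (ModuleCat.ofHom g) ≠ 0 := by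
    rw [Ne, Ext.mk₀_eq_zero_iff]
    intro h
    have h1 : g 1 = 0 := congrArg (fun φ => φ.hom (1 : R)) h
    exact one_ne_zero (α := R ⧸ Ideal.ofList rs) h1
  obtain ⟨X, e, he⟩ := exists_ext_ne_zero_of_isWeaklyRegular S rs
    (fun r hr x => by
      obtain ⟨y, rfl⟩ := Submodule.Quotient.mk_surjective _ x
      rw [← Submodule.Quotient.mk_smul, Submodule.Quotient.mk_eq_zero]
      exact Ideal.mul_mem_right _ _ (Ideal.subset_span hr)) hrs.toIsWeaklyRegular _ hg
  have := (projectiveDimension_le_iff X d).mp ((le_iSup _ X).trans hd)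
  exact he (e.eq_zero_of_hasProjectiveDimensionLT (d + 1) (by omega))

end RegularSequence

/-! ### Regular sequences in regular local rings -/

section RegularLocalRing

open IsLocalRing RingTheory.Sequence
open scoped Pointwise

/-- Dividing by an element of `m` outside `m²` lowers the number of generators of the maximal ideal
`m`: the element can replace one of the generators. -/
theorem spanFinrank_maximalIdeal_quotient_succ_le {R : Type v} [CommRing R] [IsLocalRing R]
    [IsNoetherianRing R] {x : R} (hx : x ∈ maximalIdeal R) (hx2 : x ∉ maximalIdeal R ^ 2)
    [IsLocalRing (R ⧸ Ideal.span {x})] :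
    (maximalIdeal (R ⧸ Ideal.span {x})).spanFinrank + 1 ≤ (maximalIdeal R).spanFinrank := by
  classical
  have hfg : (maximalIdeal R).FG := (maximalIdeal R).fg_of_isNoetherianRing
  have hfin := Submodule.FG.finite_generators hfg
  let s := hfin.toFinset
  have hs : Ideal.span (s : Set R) = maximalIdeal R := by
    simpa [s] using (maximalIdeal R).span_generators
  have hsm (z : R) (hz : z ∈ s) : z ∈ maximalIdeal R := hs ▸ Ideal.subset_span hz
  have hcard : s.card = (maximalIdeal R).spanFinrank := by
    rw [← Submodule.FG.generators_ncard hfg, Set.ncard_eq_toFinset_card _ hfin]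
  obtain ⟨c, -, hc⟩ := Submodule.mem_span_finset.mp
    (show x ∈ Ideal.span (s : Set R) by rwa [hs])
  -- some coefficient of `x` is a unit, since otherwise `x` would lie in `m²`
  obtain ⟨y, hys, hy⟩ : ∃ y ∈ s, IsUnit (c y) := by
    by_contra! h
    refine hx2 (hc ▸ Ideal.sum_mem _ fun z hz => ?_)
    rw [pow_two]
    exact Ideal.mul_mem_mul ((mem_maximalIdeal _).mpr (h z hz)) (hsm z hz)
  let q := Ideal.Quotient.mk (Ideal.span {x})
  have hspan : maximalIdeal (R ⧸ Ideal.span {x}) =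
      Ideal.span (((s.erase y).image q : Finset _) : Set (R ⧸ Ideal.span {x})) := by
    rw [← IsLocalRing.map_maximalIdeal_of_surjective q Ideal.Quotient.mk_surjective, ← hs,
      Ideal.map_span]
    refine le_antisymm (Ideal.span_le.mpr ?_) (Ideal.span_mono ?_)
    · rintro _ ⟨z, hz, rfl⟩
      have herase (z : R) (hz : z ∈ s.erase y) :
          q z ∈ Ideal.span (((s.erase y).image q : Finset _) : Set (R ⧸ Ideal.span {x})) :=
        Ideal.subset_span (Finset.mem_coe.mpr (Finset.mem_image_of_mem q hz))
      by_cases hzy : z = y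
      · subst hzy
        have h0 : q (c z) * q z = - ∑ a ∈ s.erase z, q (c a) * q a := by
          have : q (∑ a ∈ s, c a • a) = 0 :=
            (congrArg q hc).trans
              (Ideal.Quotient.eq_zero_iff_mem.mpr (Ideal.mem_span_singleton_self x))
          rw [← Finset.add_sum_erase s _ hys] at this
          simp only [smul_eq_mul, map_add, map_mul, map_sum] at this
          exact eq_neg_of_add_eq_zero_left this
        refine (Ideal.unit_mul_mem_iff_mem _ (hy.map q)).mp ?_
        rw [h0]
        exact neg_mem (Ideal.sum_mem _ fun a ha => Ideal.mul_mem_left _ _ (herase a ha))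
      · exact herase z (Finset.mem_erase.mpr ⟨hzy, hz⟩)
    · rw [Finset.coe_image]
      exact Set.image_mono (Finset.coe_subset.mpr (Finset.erase_subset _ _))
  have h1 : (maximalIdeal (R ⧸ Ideal.span {x})).spanFinrank ≤ (s.erase y).card := by
    rw [hspan]
    refine (Submodule.spanFinrank_span_le_ncard_of_finite (Finset.finite_toSet _)).trans ?_
    rw [Set.ncard_coe_finset]
    exact Finset.card_image_le
  rw [← hcard, ← Finset.card_erase_add_one hys]
  exact Nat.add_le_add_right h1 1

/-- If `x` generates a prime ideal of a Noetherian local ring and lies in no minimal prime, then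
the ring is a domain: a minimal prime `p` below `(x)` satisfies `p = x p`. -/
theorem isDomain_of_isPrime_span_singleton {R : Type v} [CommRing R] [IsLocalRing R]
    [IsNoetherianRing R] {x : R} (hx : x ∈ maximalIdeal R)
    (hmin : ∀ p ∈ minimalPrimes R, x ∉ p) (hprime : (Ideal.span {x}).IsPrime) : IsDomain R := by
  obtain ⟨p, hp, hpx⟩ := Ideal.exists_minimalPrimes_le (bot_le : ⊥ ≤ Ideal.span {x})
  have hpp : p.IsPrime := hp.1.1
  have hle : p ≤ maximalIdeal R • p := fun y hy => by
    obtain ⟨z, rfl⟩ := Ideal.mem_span_singleton'.mp (hpx hy)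
    have hz : z ∈ p := (hpp.mem_or_mem hy).resolve_right (hmin p hp)
    rw [mul_comm]
    exact Submodule.smul_mem_smul hx hz
  have hbot : p = ⊥ := Submodule.eq_bot_of_le_smul_of_le_jacobson_bot (maximalIdeal R) p
    p.fg_of_isNoetherianRing hle (maximalIdeal_le_jacobson _)
  rw [hbot] at hpp
  exact IsDomain.of_bot_isPrime R

/-- A regular local ring of positive dimension has an element of `m` outside `m²` and outside all
minimal primes. -/
theorem exists_mem_maximalIdeal_notMem_sq_notMem_minimalPrimes {R : Type v} [CommRing R]
    [IsRegularLocalRing R] {d : ℕ} (hd : ringKrullDim R = (d + 1 : ℕ)) :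
    ∃ x ∈ maximalIdeal R, x ∉ maximalIdeal R ^ 2 ∧ ∀ p ∈ minimalPrimes R, x ∉ p := by
  classical
  have hfg : (maximalIdeal R).FG := (maximalIdeal R).fg_of_isNoetherianRing
  by_contra! h
  let P : Finset (Ideal R) := (minimalPrimes.finite_of_isNoetherianRing R).toFinset
  have hsub : (maximalIdeal R : Set R) ⊆
      ⋃ i ∈ ((insert (maximalIdeal R ^ 2) P : Finset (Ideal R)) : Set (Ideal R)),
        (id i : Ideal R) := by
    intro x hx
    by_cases hx2 : x ∈ maximalIdeal R ^ 2
    · exact Set.mem_biUnion (by simp) hx2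
    · obtain ⟨p, hp, hxp⟩ := h x hx hx2
      exact Set.mem_biUnion (x := p) (by simp [P, hp]) hxp
  obtain ⟨i, hi, hle⟩ := (Ideal.subset_union_prime (maximalIdeal R ^ 2) (maximalIdeal R ^ 2)
    (fun i hi h1 _ => by
      have : i ∈ minimalPrimes R := by simpa [P, h1] using hi
      exact this.1.1)).mp hsub
  rcases Finset.mem_insert.mp hi with rfl | hi
  · have hbot : maximalIdeal R = ⊥ :=
      Submodule.eq_bot_of_le_smul_of_le_jacobson_bot (maximalIdeal R) _ hfg
        (by simpa [pow_two] using hle) (maximalIdeal_le_jacobson _)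
    have := (isRegularLocalRing_iff R).mp inferInstance
    rw [(Submodule.spanFinrank_eq_zero_iff_eq_bot hfg).mpr hbot, hd] at this
    norm_cast at this
  · have hi' : i ∈ minimalPrimes R := by simpa [P] using hi
    have : i.IsPrime := hi'.1.1
    obtain rfl : maximalIdeal R = i := le_antisymm hle (le_maximalIdeal this.ne_top)
    have h0 := Ideal.height_eq_zero_iff.mpr hi'
    have := maximalIdeal_height_eq_ringKrullDim (R := R)
    rw [h0, hd] at this
    norm_cast at this

/-- Induction on the dimension. For a suitable `x` in `m` outside `m²` the quotient by `x` is
regular of dimension one less, hence a domain; so `x` generates a prime ideal, `R` is a domain, `x` is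
regular, and a regular sequence of the quotient lifts. -/
theorem exists_isWeaklyRegular_of_isRegularLocalRing (d : ℕ) :
    ∀ (R : Type v) [CommRing R] [IsRegularLocalRing R], ringKrullDim R = d →
      IsDomain R ∧ ∃ rs : List R, IsWeaklyRegular R rs ∧ (∀ r ∈ rs, r ∈ maximalIdeal R) ∧
        rs.length = d := by
  induction d with
  | zero =>
    intro R _ _ hd
    have hfg : (maximalIdeal R).FG := (maximalIdeal R).fg_of_isNoetherianRing
    have hbot : maximalIdeal R = ⊥ := by
      rw [← Submodule.spanFinrank_eq_zero_iff_eq_bot hfg]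
      have := (isRegularLocalRing_iff R).mp inferInstance
      rw [hd] at this
      exact_mod_cast this
    have hf := isField_iff_maximalIdeal_eq.mpr hbot
    exact ⟨hf.isDomain, [], IsWeaklyRegular.nil R R, by simp, rfl⟩
  | succ d ih =>
    intro R _ _ hd
    obtain ⟨x, hx, hx2, hxmin⟩ := exists_mem_maximalIdeal_notMem_sq_notMem_minimalPrimes hd
    have hnt : Nontrivial (R ⧸ Ideal.span {x}) := Ideal.Quotient.nontrivial_iff.mpr fun h =>
      (maximalIdeal.isMaximal R).ne_top (top_le_iff.mp (h ▸
        (Ideal.span_singleton_le_iff_mem _).mpr hx))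
    have hloc : IsLocalRing (R ⧸ Ideal.span {x}) :=
      IsLocalRing.of_surjective' (Ideal.Quotient.mk _) Ideal.Quotient.mk_surjective
    have hrank := spanFinrank_maximalIdeal_quotient_succ_le hx hx2
    rw [show (maximalIdeal R).spanFinrank = d + 1 by
      have := (isRegularLocalRing_iff R).mp inferInstance
      rw [hd] at this
      exact_mod_cast this] at hrank
    have hdim : ringKrullDim R ≤ ringKrullDim (R ⧸ Ideal.span {x}) + 1 := by
      have := ringKrullDim_le_ringKrullDim_quotient_add_encard {x} (R := R) (by
        rw [ringJacobson_eq_maximalIdeal]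
        simpa using hx)
      simpa using this
    have hdim' : (d : WithBot ℕ∞) ≤ ringKrullDim (R ⧸ Ideal.span {x}) := by
      rw [hd] at hdim
      push_cast at hdim
      exact (ENat.WithBot.add_le_add_one_right_iff).mp hdim
    have hle : ((maximalIdeal (R ⧸ Ideal.span {x})).spanFinrank : WithBot ℕ∞) ≤ d := by
      exact_mod_cast Nat.le_of_succ_le_succ hrank
    have hreg := IsRegularLocalRing.of_spanFinrank_maximalIdeal_le _ (hle.trans hdim')
    have hdimq : ringKrullDim (R ⧸ Ideal.span {x}) = d :=
      le_antisymm ((isRegularLocalRing_iff _).mp hreg ▸ hle) hdim'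
    obtain ⟨hdom, rs, hrs, hrsm, hlen⟩ := ih (R ⧸ Ideal.span {x}) hdimq
    have hR := isDomain_of_isPrime_span_singleton hx hxmin
      ((Ideal.Quotient.isDomain_iff_prime _).mp hdom)
    obtain ⟨rs, rfl⟩ := List.map_surjective_iff.mpr
      (Ideal.Quotient.mk_surjective (I := Ideal.span {x})) rs
    refine ⟨hR, x :: rs, ?_, ?_, by simpa using hlen⟩
    · rw [isWeaklyRegular_cons_iff]
      have hx0 : x ≠ 0 := fun h => hx2 (h ▸ zero_mem _)
      refine ⟨IsSMulRegular.of_ne_zero hx0, ?_⟩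
      have h1 : IsWeaklyRegular (R ⧸ Ideal.span {x}) rs :=
        (isWeaklyRegular_map_algebraMap_iff (R ⧸ Ideal.span {x}) (R ⧸ Ideal.span {x}) rs).mp hrs
      refine ((Submodule.quotEquivOfEq _ _ ?_).isWeaklyRegular_congr rs).mpr h1
      rw [← Submodule.ideal_span_singleton_smul]
      simp
    · intro r hr
      rcases List.mem_cons.mp hr with rfl | hr
      · exact hx
      · have := hrsm _ (List.mem_map_of_mem hr)
        rw [mem_maximalIdeal, mem_nonunits_iff] at this ⊢
        exact fun hu => this (hu.map _)

theorem exists_isRegular_of_isRegularLocalRing (R : Type v) [CommRing R] [IsRegularLocalRing R] :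
    ∃ rs : List R, IsRegular R rs ∧ ((rs.length : ℕ∞) : WithBot ℕ∞) = ringKrullDim R := by
  have hd := (isRegularLocalRing_iff R).mp inferInstance
  obtain ⟨-, rs, hrs, hm, hlen⟩ := exists_isWeaklyRegular_of_isRegularLocalRing _ R hd.symm
  refine ⟨rs, (isRegular_iff_isWeaklyRegular_of_subset_maximalIdeal hm).mpr hrs, ?_⟩
  rw [hlen, ← hd]
  rfl

end RegularLocalRing

/-! ### Krull dimension -/

section KrullDimension

variable {A : Type v} [CommRing A]

theorem IsCohenMacaulayAt.ringKrullDim_le {p : Ideal A} [p.IsPrime] (hp : IsCohenMacaulayAt A p)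
    {d : ℕ} (hd : globalProjectiveDimension A ≤ (d : WithBot ℕ∞)) :
    ringKrullDim (Localization.AtPrime p) ≤ (d : WithBot ℕ∞) := by
  obtain ⟨rs, hrs, -, hlen⟩ := hp
  rw [← hlen]
  exact_mod_cast length_le_of_isRegular_of_globalProjectiveDimension_le p.primeCompl hrs hd

theorem IsRegularRing.ringKrullDim_le (hA : IsRegularRing A) {d : ℕ}
    (hd : globalProjectiveDimension A ≤ (d : WithBot ℕ∞)) :
    ringKrullDim A ≤ (d : WithBot ℕ∞) := by
  refine (ringKrullDim_le_iff_height_le _).mpr fun p hp => ?_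
  obtain ⟨rs, hrs, hlen⟩ := exists_isRegular_of_isRegularLocalRing (Localization.AtPrime p)
  rw [IsLocalization.AtPrime.ringKrullDim_eq_height p] at hlen
  rw [← WithBot.coe_inj.mp hlen]
  exact_mod_cast length_le_of_isRegular_of_globalProjectiveDimension_le p.primeCompl hrs hd

end KrullDimension

theorem mainTheorem1 (A : Type v) [CommRing A] :
    (∀ (k : Type u) [CommRing k] [Algebra k A],
      relativeWeakDimension k A ≤ HCHDim k A ∧
      relativeGlobalProjectiveDimension k A ≤ HCHDim k A ∧
      relativeProjectiveDimension k (A ⊗[k] A) (diagonalBimodule k A) ≤ HCHDim k A) ∧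
    (∀ (k : Type u) [Field k] [Algebra k A],
      (weakDimension A ≤ HCHDim k A ∧
        globalProjectiveDimension A ≤ (HCHDim k A : WithBot ℕ∞) ∧
        CategoryTheory.projectiveDimension (diagonalBimodule k A) ≤
          (HCHDim k A : WithBot ℕ∞)) ∧
      (∀ (m : Ideal A) [m.IsMaximal], IsCohenMacaulayAt A m →
        ringKrullDim (Localization.AtPrime m) ≤ (HCHDim k A : WithBot ℕ∞) ∧
        (2 ≤ ringKrullDim (Localization.AtPrime m) → ¬ IsQuasiFree k A)) ∧
      (IsRegularRing A →
        ringKrullDim A ≤ (HCHDim k A : WithBot ℕ∞) ∧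
        (2 ≤ ringKrullDim A → ¬ IsQuasiFree k A))) := by
  have hnot {x : WithBot ℕ∞} (h1 : x ≤ (1 : ℕ)) (h2 : 2 ≤ x) : False := by
    have h := h2.trans h1
    revert h
    norm_cast
  refine ⟨fun k _ _ => ⟨?_, ?_, ?_⟩, fun k _ _ => ⟨⟨?_, ?_, ?_⟩, fun m _ hm => ⟨?_, ?_⟩,
    fun hA => ⟨?_, ?_⟩⟩⟩
  · exact WithBot.coe_le_coe.mp <| le_HCHDim_of_forall fun n H =>
      WithBot.coe_le_coe.mpr H.relativeWeakDimension_le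
  · exact WithBot.coe_le_coe.mp <| le_HCHDim_of_forall fun n H =>
      WithBot.coe_le_coe.mpr H.relativeGlobalProjectiveDimension_le
  · exact WithBot.coe_le_coe.mp <| le_HCHDim_of_forall fun n H =>
      WithBot.coe_le_coe.mpr (iInf₂_le n H.hasRelativeDimensionLE_diagonalBimodule)
  · exact WithBot.coe_le_coe.mp <| le_HCHDim_of_forall fun n H =>
      WithBot.coe_le_coe.mpr H.weakDimension_le
  · exact le_HCHDim_of_forall fun n H => H.globalProjectiveDimension_le
  · exact le_HCHDim_of_forall fun n H => H.projectiveDimension_diagonalBimodule_le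
  · exact le_HCHDim_of_forall fun n H => hm.ringKrullDim_le H.globalProjectiveDimension_le
  · exact fun h2 hqf => hnot
      (hm.ringKrullDim_le hqf.hochschildCohomologyVanishes.globalProjectiveDimension_le) h2
  · exact le_HCHDim_of_forall fun n H => hA.ringKrullDim_le H.globalProjectiveDimension_le
  · exact fun h2 hqf => hnot
      (hA.ringKrullDim_le hqf.hochschildCohomologyVanishes.globalProjectiveDimension_le) h2
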